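/- Let $\mathbb K=\mathbb R$ or $\mathbb C$, let $\sigma\in\mathbb K$, and let $\mathcal Q^{1/2}u(x)=\frac1{\sqrt\pi}\int_{-1}^x\frac{u(t)}{\sqrt{x-t}}\,dt$ be the half-integral, a bounded operator on $L^2[-1,1]$ ($\mathbb K$-valued functions). Let $P_n$ be the Legendre polynomials and $U_n$ the Chebyshev polynomials of the second kind. On sequences $v=(v_n)_{n\ge0}$ in $\mathbb K$ define the banded infinite matrices $$(Q_{\mathbf P}^{1/2}v)_n=\tfrac{2}{\sqrt\pi}\Big(\tfrac{v_n}{2n+1}-\tfrac{v_{n+1}}{2n+3}\Big),\qquad (Q_{\mathbf U}^{1/2}v)_n=\tfrac{\sqrt\pi}{2}(v_n+v_{n-1})\quad(v_{-1}:=0),$$ $Q_{\mathbf P}=Q_{\mathbf U}^{1/2}Q_{\mathbf P}^{1/2}$, $\Psi=\mathrm{diag}\big(\sqrt{2/(2n+1)}\big)_{n\ge0}$ and $\tilde Q_{\mathbf P}=\Psi Q_{\mathbf P}\Psi^{-1}$ (the normalized Legendre integration matrix). For $\lambda\ge0$ let $\ell^2_\lambda$ be the Banach space of sequences with $\|v\|_{\ell^2_\lambda}^2=\sum_{k\ge0}(k+1)^{2\lambda}|v_k|^2<\infty$.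 A matrix is called invertible on a Banach space of sequences if it restricts to a bounded bijection of that space onto itself with bounded inverse. Suppose that $\sigma I+\mathcal Q^{1/2}$ is invertible on $L^2[-1,1]$. Then: 1. $\sigma^2I+\tilde Q_{\mathbf P}$ and $\tilde Q_{\mathbf P}-\sigma^2I$ are both invertible on $\ell^2_\lambda$ for every $\lambda\ge0$, and on $\ell^1$. 2. Let $\underline e,\underline f\in\ell^1$. There is exactly one sequence $\underline a$ with $\Psi\underline a\in\ell^1$ and $(\tilde Q_{\mathbf P}-\sigma^2I)\Psi\underline a=\Psi\,(Q_{\mathbf U}^{1/2}\underline f-\sigma\underline e)$. It lies in $\ell^1$ and satisfies the Schur complement equation $(Q_{\mathbf P}-\sigma^2I)\underline a=Q_{\mathbf U}^{1/2}\underline f-\sigma\underline e$. Put $$e=\sum_n e_nP_n,\quad f=\sum_n f_nU_n,\quad a=\sum_n a_nP_n,\quad b=\sigma^{-1}\Big(f-\sum_n(Q_{\mathbf P}^{1/2}\underline a)_nU_n\Big),$$ $$g(x)=e(x)+\sqrt{1+x}\,f(x),\qquad u(x)=a(x)+\sqrt{1+x}\,b(x).$$ All these series converge absolutely at every $x\in(-1,1)$.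 For every $x\in(-1,1)$ the function $t\mapsto u(t)(x-t)^{-1/2}$ is integrable on $(-1,x)$ and $\sigma u(x)+\mathcal Q^{1/2}u(x)=g(x)$. Moreover $u\in L^2[-1,1]$ if and only if $g\in L^2[-1,1]$, and in that case $u$ is the unique $L^2$ solution, $u=(\sigma I+\mathcal Q^{1/2})^{-1}g$. The condition $g\in L^2[-1,1]$ holds in particular whenever $\sum_n\sqrt{n+1}\,|f_n|<\infty$. -/

import Mathlib

open MeasureTheory Set
open scoped ENNReal

noncomputable section

namespace HalfInt

/-! ### The half-integral on `L²[-1,1]` -/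

/-- Lebesgue measure on `[-1,1]`. -/
abbrev mu : Measure ℝ := volume.restrict (Icc (-1 : ℝ) 1)

/-- The left-sided half-integral
`(Q^{1/2} f)(x) = π^{-1/2} ∫_{-1}^x f(t) (x-t)^{-1/2} dt`. -/
def halfInt {𝕜 : Type*} [RCLike 𝕜] (f : ℝ → 𝕜) (x : ℝ) : 𝕜 :=
  (√Real.pi)⁻¹ • ∫ t in (-1 : ℝ)..x, (√(x - t))⁻¹ • f t

/-- The kernel of the half-integral on `[-1,1]`, without the factor `π^{-1/2}`; it vanishes for
`t ≥ x` because `√s = 0` for `s ≤ 0`. -/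
def kerE (x t : ℝ) : ℝ≥0∞ := ENNReal.ofReal (√(x - t))⁻¹

/-- The bound `∫_0^2 s^{-1/2} ds` in the Schur test. -/
def kerBound : ℝ≥0∞ := ∫⁻ s in Ioc (0 : ℝ) 2, ENNReal.ofReal (√s)⁻¹

lemma kerBound_lt_top : kerBound < ∞ := by
  have h : IntervalIntegrable (fun s : ℝ => s ^ (-(1 / 2) : ℝ)) volume 0 2 :=
    intervalIntegral.intervalIntegrable_rpow' (by norm_num)
  rw [intervalIntegrable_iff_integrableOn_Ioc_of_le (by norm_num)] at h
  have h2 : ∫⁻ s in Ioc (0 : ℝ) 2, ‖s ^ (-(1 / 2) : ℝ)‖ₑ < ∞ := h.2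
  refine lt_of_le_of_lt (le_of_eq ?_) h2
  refine setLIntegral_congr_fun measurableSet_Ioc fun s hs => ?_
  rw [← ofReal_norm, Real.norm_of_nonneg (Real.rpow_nonneg hs.1.le _),
    Real.rpow_neg hs.1.le, Real.sqrt_eq_rpow]

lemma measurable_kerE : Measurable (Function.uncurry kerE) := by
  unfold kerE Function.uncurry
  fun_prop

lemma kerE_le (x t : ℝ) (hx : x ∈ Icc (-1 : ℝ) 1) (ht : t ∈ Icc (-1 : ℝ) 1) :
    kerE x t ≤ (Ioc (0 : ℝ) 2).indicator (fun s => ENNReal.ofReal (√s)⁻¹) (x - t) := by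
  by_cases h : x - t ∈ Ioc (0 : ℝ) 2
  · simp [h, kerE]
  · have : x - t ≤ 0 := by
      by_contra h'
      exact h ⟨by linarith, by linarith [hx.2, ht.1]⟩
    simp [kerE, Real.sqrt_eq_zero_of_nonpos this]

lemma lintegral_kerE_right (x : ℝ) (hx : x ∈ Icc (-1 : ℝ) 1) :
    ∫⁻ t, kerE x t ∂mu ≤ kerBound := by
  calc ∫⁻ t, kerE x t ∂mu
      ≤ ∫⁻ t in Icc (-1 : ℝ) 1,
        (Ioc (0 : ℝ) 2).indicator (fun s => ENNReal.ofReal (√s)⁻¹) (x - t) :=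
        setLIntegral_mono' measurableSet_Icc fun t ht => kerE_le x t hx ht
    _ ≤ ∫⁻ t, (Ioc (0 : ℝ) 2).indicator (fun s => ENNReal.ofReal (√s)⁻¹) (x - t) :=
        setLIntegral_le_lintegral _ _
    _ = kerBound := by
        rw [lintegral_sub_left_eq_self
          (fun s => (Ioc (0 : ℝ) 2).indicator (fun s => ENNReal.ofReal (√s)⁻¹) s),
          lintegral_indicator measurableSet_Ioc, kerBound]

lemma lintegral_kerE_left (t : ℝ) (ht : t ∈ Icc (-1 : ℝ) 1) :
    ∫⁻ x, kerE x t ∂mu ≤ kerBound := by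
  calc ∫⁻ x, kerE x t ∂mu
      ≤ ∫⁻ x in Icc (-1 : ℝ) 1,
        (Ioc (0 : ℝ) 2).indicator (fun s => ENNReal.ofReal (√s)⁻¹) (x - t) :=
        setLIntegral_mono' measurableSet_Icc fun x hx => kerE_le x t hx ht
    _ ≤ ∫⁻ x, (Ioc (0 : ℝ) 2).indicator (fun s => ENNReal.ofReal (√s)⁻¹) (x - t) :=
        setLIntegral_le_lintegral _ _
    _ = kerBound := by
        rw [lintegral_sub_right_eq_self
          (fun s => (Ioc (0 : ℝ) 2).indicator (fun s => ENNReal.ofReal (√s)⁻¹) s),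
          lintegral_indicator measurableSet_Ioc, kerBound]

lemma lintegral_sq_le {g : ℝ → ℝ≥0∞} (hg : AEMeasurable g mu) :
    ∫⁻ x, (∫⁻ t, kerE x t * g t ∂mu) ^ (2 : ℝ) ∂mu
      ≤ kerBound ^ (2 : ℝ) * ∫⁻ t, g t ^ (2 : ℝ) ∂mu := by
  have hk : ∀ x, Measurable (kerE x) := fun x => measurable_kerE.comp measurable_prodMk_left
  have hk' : ∀ t, Measurable (fun x => kerE x t) :=
    fun t => measurable_kerE.comp measurable_prodMk_right
  have hg2 : AEMeasurable (fun t => g t ^ (2 : ℝ)) mu := hg.pow_const _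
  have step : ∀ x ∈ Icc (-1 : ℝ) 1, (∫⁻ t, kerE x t * g t ∂mu) ^ (2 : ℝ)
      ≤ kerBound * ∫⁻ t, kerE x t * g t ^ (2 : ℝ) ∂mu := by
    intro x hx
    have h := ENNReal.lintegral_mul_norm_pow_le (μ := mu) (hk x).aemeasurable
      ((hk x).aemeasurable.mul hg2) (p := 1 / 2) (q := 1 / 2)
      (by norm_num) (by norm_num) (by norm_num)
    have e : ∀ t, kerE x t ^ (1 / 2 : ℝ) * (kerE x * fun t => g t ^ (2 : ℝ)) t ^ (1 / 2 : ℝ)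
        = kerE x t * g t := by
      intro t
      simp only [Pi.mul_apply]
      rw [ENNReal.mul_rpow_of_nonneg _ _ (by norm_num), ← ENNReal.rpow_mul, ← mul_assoc,
        ← ENNReal.rpow_add_of_nonneg _ _ (by norm_num) (by norm_num)]
      norm_num
    simp only [e] at h
    calc (∫⁻ t, kerE x t * g t ∂mu) ^ (2 : ℝ)
        ≤ ((∫⁻ t, kerE x t ∂mu) ^ (1 / 2 : ℝ) *
          (∫⁻ t, kerE x t * g t ^ (2 : ℝ) ∂mu) ^ (1 / 2 : ℝ)) ^ (2 : ℝ) := by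
          gcongr
          exact h
      _ = (∫⁻ t, kerE x t ∂mu) * ∫⁻ t, kerE x t * g t ^ (2 : ℝ) ∂mu := by
          rw [ENNReal.mul_rpow_of_nonneg _ _ (by norm_num), ← ENNReal.rpow_mul,
            ← ENNReal.rpow_mul]
          norm_num
      _ ≤ _ := by
          gcongr
          exact lintegral_kerE_right x hx
  calc ∫⁻ x, (∫⁻ t, kerE x t * g t ∂mu) ^ (2 : ℝ) ∂mu
      ≤ ∫⁻ x, kerBound * ∫⁻ t, kerE x t * g t ^ (2 : ℝ) ∂mu ∂mu :=
        setLIntegral_mono' measurableSet_Icc step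
    _ = kerBound * ∫⁻ x, ∫⁻ t, kerE x t * g t ^ (2 : ℝ) ∂mu ∂mu :=
        lintegral_const_mul' _ _ kerBound_lt_top.ne
    _ = kerBound * ∫⁻ t, ∫⁻ x, kerE x t * g t ^ (2 : ℝ) ∂mu ∂mu := by
        rw [lintegral_lintegral_swap]
        exact measurable_kerE.aemeasurable.mul hg2.comp_snd
    _ ≤ kerBound * ∫⁻ t, kerBound * g t ^ (2 : ℝ) ∂mu := by
        gcongr 1
        refine setLIntegral_mono' measurableSet_Icc fun t ht => ?_
        rw [lintegral_mul_const _ (hk' t)]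
        gcongr
        exact lintegral_kerE_left t ht
    _ = kerBound ^ (2 : ℝ) * ∫⁻ t, g t ^ (2 : ℝ) ∂mu := by
        rw [lintegral_const_mul' _ _ kerBound_lt_top.ne, ← mul_assoc, ENNReal.rpow_two, sq]

section Lemmas

variable {𝕜 : Type*} [RCLike 𝕜]

lemma enorm_ker_smul (x t : ℝ) (f : ℝ → 𝕜) :
    ‖(√(x - t))⁻¹ • f t‖ₑ = kerE x t * ‖f t‖ₑ := by
  rw [enorm_smul, kerE, ← ofReal_norm, Real.norm_of_nonneg (by positivity)]

lemma halfInt_eq (f : ℝ → 𝕜) {x : ℝ} (hx : x ∈ Icc (-1 : ℝ) 1) :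
    halfInt f x = (√Real.pi)⁻¹ • ∫ t, (√(x - t))⁻¹ • f t ∂mu := by
  unfold halfInt
  congr 1
  rw [intervalIntegral.integral_of_le hx.1, ← integral_Icc_eq_integral_Ioc]
  refine (setIntegral_eq_of_subset_of_forall_sdiff_eq_zero measurableSet_Icc
    (Icc_subset_Icc_right hx.2) fun t ht => ?_).symm
  have : x - t ≤ 0 := by
    by_contra h
    exact ht.2 ⟨ht.1.1, by linarith⟩
  simp [Real.sqrt_eq_zero_of_nonpos this]

lemma halfInt_congr {f g : ℝ → 𝕜} (h : f =ᵐ[mu] g) {x : ℝ} (hx : x ∈ Icc (-1 : ℝ) 1) :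
    halfInt f x = halfInt g x := by
  rw [halfInt_eq f hx, halfInt_eq g hx]
  congr 1
  refine integral_congr_ae ?_
  filter_upwards [h] with t ht
  rw [ht]

lemma ae_integrable_ker {f : ℝ → 𝕜} (hf : MemLp f 2 mu) :
    ∀ᵐ x ∂mu, Integrable (fun t => (√(x - t))⁻¹ • f t) mu := by
  have hfm := hf.1
  have h2 : ∫⁻ t, ‖f t‖ₑ ^ (2 : ℝ) ∂mu < ∞ := by
    simpa using lintegral_rpow_enorm_lt_top_of_eLpNorm_lt_top two_ne_zero ENNReal.ofNat_ne_top hf.2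
  have h := lintegral_sq_le (g := fun t => ‖f t‖ₑ) hfm.enorm
  have hm : AEMeasurable (fun x => (∫⁻ t, kerE x t * ‖f t‖ₑ ∂mu) ^ (2 : ℝ)) mu := by
    refine AEMeasurable.pow_const ?_ _
    exact (measurable_kerE.aemeasurable.mul hfm.enorm.comp_snd).lintegral_prod_right'
  have hfin : ∫⁻ x, (∫⁻ t, kerE x t * ‖f t‖ₑ ∂mu) ^ (2 : ℝ) ∂mu ≠ ∞ :=
    (h.trans_lt (ENNReal.mul_lt_top
      (ENNReal.rpow_lt_top_of_nonneg (by norm_num) kerBound_lt_top.ne) h2)).ne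
  filter_upwards [ae_lt_top' hm hfin] with x hx
  refine ⟨?_, ?_⟩
  · refine AEStronglyMeasurable.smul ?_ hfm
    exact (by fun_prop : Measurable fun t : ℝ => (√(x - t))⁻¹).aestronglyMeasurable
  · rw [hasFiniteIntegral_iff_enorm]
    simp only [enorm_ker_smul]
    by_contra hc
    rw [not_lt, top_le_iff] at hc
    rw [hc] at hx
    simp at hx

lemma aestronglyMeasurable_halfInt {f : ℝ → 𝕜} (hf : AEStronglyMeasurable f mu) :
    AEStronglyMeasurable (halfInt f) mu := by
  have h : AEStronglyMeasurable (fun x => (√Real.pi)⁻¹ • ∫ t, (√(x - t))⁻¹ • f t ∂mu) mu := by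
    refine AEStronglyMeasurable.const_smul ?_ _
    refine AEStronglyMeasurable.integral_prod_right'
      (f := fun p : ℝ × ℝ => (√(p.1 - p.2))⁻¹ • f p.2) ?_
    refine AEStronglyMeasurable.smul ?_ hf.comp_snd
    exact (by fun_prop : Measurable fun p : ℝ × ℝ => (√(p.1 - p.2))⁻¹).aestronglyMeasurable
  refine h.congr ?_
  filter_upwards [ae_restrict_mem measurableSet_Icc] with x hx
  rw [halfInt_eq f hx]

lemma eLpNorm_halfInt_le {f : ℝ → 𝕜} (hf : AEStronglyMeasurable f mu) :
    eLpNorm (halfInt f) 2 mu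
      ≤ ENNReal.ofReal ((√Real.pi)⁻¹ * kerBound.toReal) * eLpNorm f 2 mu := by
  have key : eLpNorm (halfInt f) 2 mu ≤ ENNReal.ofReal (√Real.pi)⁻¹ *
      eLpNorm (fun x => ∫⁻ t, kerE x t * ‖f t‖ₑ ∂mu) 2 mu := by
    have : ENNReal.ofReal (√Real.pi)⁻¹ = ‖(√Real.pi)⁻¹‖ₑ := by
      rw [← ofReal_norm, Real.norm_of_nonneg (by positivity)]
    have e1 : eLpNorm (halfInt f) 2 mu
        = eLpNorm ((√Real.pi)⁻¹ • fun x => ∫ t, (√(x - t))⁻¹ • f t ∂mu) 2 mu := by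
      refine eLpNorm_congr_ae ?_
      filter_upwards [ae_restrict_mem measurableSet_Icc] with x hx
      rw [halfInt_eq f hx]
      rfl
    rw [e1, eLpNorm_const_smul, this]
    gcongr 1
    refine eLpNorm_mono_enorm fun x => ?_
    refine (enorm_integral_le_lintegral_enorm _).trans (le_of_eq ?_)
    simp only [enorm_ker_smul, enorm_eq_self]
  refine key.trans ?_
  rw [ENNReal.ofReal_mul (by positivity), ENNReal.ofReal_toReal kerBound_lt_top.ne, mul_assoc]
  gcongr 1
  have h := lintegral_sq_le (g := fun t => ‖f t‖ₑ) hf.enorm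
  rw [eLpNorm_eq_lintegral_rpow_enorm_toReal two_ne_zero ENNReal.ofNat_ne_top,
    eLpNorm_eq_lintegral_rpow_enorm_toReal two_ne_zero ENNReal.ofNat_ne_top]
  simp only [ENNReal.toReal_ofNat, enorm_eq_self]
  calc _ ≤ (kerBound ^ (2 : ℝ) * ∫⁻ t, ‖f t‖ₑ ^ (2 : ℝ) ∂mu) ^ (1 / 2 : ℝ) := by
        gcongr
    _ = _ := by
        rw [ENNReal.mul_rpow_of_nonneg _ _ (by norm_num), ← ENNReal.rpow_mul]
        norm_num

lemma memLp_halfInt {f : ℝ → 𝕜} (hf : MemLp f 2 mu) : MemLp (halfInt f) 2 mu :=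
  ⟨aestronglyMeasurable_halfInt hf.1,
    (eLpNorm_halfInt_le hf.1).trans_lt (ENNReal.mul_lt_top ENNReal.ofReal_lt_top hf.2)⟩

end Lemmas

/-- The half-integral as a bounded operator on `L²[-1,1]`. -/
def halfIntL2 (𝕜 : Type*) [RCLike 𝕜] : Lp 𝕜 2 mu →L[𝕜] Lp 𝕜 2 mu :=
  LinearMap.mkContinuous
    { toFun := fun u => (memLp_halfInt (Lp.memLp u)).toLp (halfInt u)
      map_add' := by
        intro u v
        rw [← MemLp.toLp_add]
        refine MemLp.toLp_congr _ _ ?_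
        filter_upwards [ae_restrict_mem measurableSet_Icc, ae_integrable_ker (Lp.memLp u),
          ae_integrable_ker (Lp.memLp v)] with x hx h1 h2
        rw [halfInt_congr (Lp.coeFn_add u v) hx, Pi.add_apply, halfInt_eq _ hx, halfInt_eq _ hx,
          halfInt_eq _ hx, ← smul_add, ← integral_add h1 h2]
        simp only [Pi.add_apply, smul_add]
      map_smul' := by
        intro c u
        rw [RingHom.id_apply, ← MemLp.toLp_const_smul]
        refine MemLp.toLp_congr _ _ ?_
        filter_upwards [ae_restrict_mem measurableSet_Icc] with x hx
        rw [halfInt_congr (Lp.coeFn_smul c u) hx, Pi.smul_apply, halfInt_eq _ hx,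
          halfInt_eq _ hx, smul_comm c, ← integral_smul c]
        congr 1
        refine integral_congr_ae (Filter.Eventually.of_forall fun t => ?_)
        simp only [Pi.smul_apply]
        exact smul_comm _ _ _ }
    ((√Real.pi)⁻¹ * kerBound.toReal)
    (by
      intro u
      change ‖(memLp_halfInt (Lp.memLp u)).toLp (halfInt u)‖ ≤ _
      rw [Lp.norm_toLp, Lp.norm_def]
      refine ENNReal.toReal_le_of_le_ofReal (by positivity) ?_
      rw [ENNReal.ofReal_mul (by positivity), ENNReal.ofReal_toReal (Lp.eLpNorm_ne_top u)]
      exact eLpNorm_halfInt_le (Lp.memLp u).1)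

/-- On representatives, `halfIntL2` is the half-integral. -/
lemma coeFn_halfIntL2 {𝕜 : Type*} [RCLike 𝕜] (u : Lp 𝕜 2 mu) : halfIntL2 𝕜 u =ᵐ[mu] halfInt u :=
  MemLp.coeFn_toLp (memLp_halfInt (Lp.memLp u))

/-! ### Legendre and Chebyshev expansions -/

/-- The Legendre polynomials, by their three-term recurrence
`(n+1) P_{n+1}(x) = (2n+1) x P_n(x) - n P_{n-1}(x)`. -/
def legendreP : ℕ → ℝ → ℝ
  | 0, _ => 1
  | 1, x => x
  | n + 2, x => ((2 * (n : ℝ) + 3) * x * legendreP (n + 1) x - ((n : ℝ) + 1) * legendreP n x)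
      / ((n : ℝ) + 2)

/-- The Chebyshev polynomials of the second kind, as functions. -/
def chebU (n : ℕ) (x : ℝ) : ℝ := (Polynomial.Chebyshev.U ℝ (n : ℤ)).eval x

section Sequences

variable {𝕜 : Type*} [RCLike 𝕜]

/-- The Legendre expansion `∑ₙ aₙ Pₙ(x)`. -/
def legendreSeries (a : ℕ → 𝕜) (x : ℝ) : 𝕜 := ∑' n, legendreP n x • a n

/-- The Chebyshev expansion `∑ₙ bₙ Uₙ(x)`. -/
def chebSeries (b : ℕ → 𝕜) (x : ℝ) : 𝕜 := ∑' n, chebU n x • b n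

/-! ### The banded infinite matrices, acting on arbitrary sequences -/

/-- The matrix of the half-integral from the basis `Pₙ` to the basis `√(1+x) Uₙ`: the upper
bidiagonal matrix `2/√π` times `(1, -1/3; 1/3, -1/5; 1/5, -1/7; …)`, which represents
`Q^{1/2} Pₙ = 2 / (√π (2n+1)) √(1+x) (Uₙ - Uₙ₋₁)`. -/
def halfP : Module.End 𝕜 (ℕ → 𝕜) where
  toFun a n := (2 / √Real.pi) •
    ((1 / (2 * (n : ℝ) + 1)) • a n - (1 / (2 * (n : ℝ) + 3)) • a (n + 1))
  map_add' a b := by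
    funext n
    simp only [Pi.add_apply, smul_add, smul_sub]
    abel
  map_smul' c a := by
    funext n
    simp only [Pi.smul_apply, RingHom.id_apply, smul_sub, smul_comm c]

/-- The matrix of the half-integral from the basis `√(1+x) Uₙ` to the basis `Pₙ`: the lower
bidiagonal matrix `√π/2` times `(1; 1, 1; 1, 1; …)`, which represents
`Q^{1/2} (√(1+x) Uₙ) = √π/2 (Pₙ + Pₙ₊₁)`. -/
def halfU : Module.End 𝕜 (ℕ → 𝕜) where
  toFun b n := (√Real.pi / 2) • (b n + if n = 0 then 0 else b (n - 1))
  map_add' a b := by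
    funext n
    by_cases h : n = 0
    · simp [h]
    · simp only [Pi.add_apply, h, if_false, ← smul_add]
      congr 1
      abel
  map_smul' c a := by
    funext n
    by_cases h : n = 0
    · simp [h]
    · simp only [Pi.smul_apply, h, if_false, RingHom.id_apply, smul_add, smul_comm c]

/-- The Legendre integration matrix `Q_P`, the product of the two half-integral matrices. -/
def intP : Module.End 𝕜 (ℕ → 𝕜) := halfU * halfP

/-- The diagonal entries `√(2/(2n+1)) = ‖Pₙ‖` of `Ψ`. -/
def psi (n : ℕ) : ℝ := √(2 / (2 * (n : ℝ) + 1))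

/-- The diagonal matrix `Ψ`. -/
def Psi : Module.End 𝕜 (ℕ → 𝕜) where
  toFun a n := psi n • a n
  map_add' a b := by
    funext n
    simp
  map_smul' c a := by
    funext n
    simp only [Pi.smul_apply, RingHom.id_apply, smul_comm c]

/-- The inverse diagonal matrix `Ψ⁻¹`. -/
def PsiInv : Module.End 𝕜 (ℕ → 𝕜) where
  toFun a n := (psi n)⁻¹ • a n
  map_add' a b := by
    funext n
    simp
  map_smul' c a := by
    funext n
    simp only [Pi.smul_apply, RingHom.id_apply, smul_comm c]

/-- The normalized Legendre integration matrix `Ψ Q_P Ψ⁻¹`. -/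
def intPNormalized : Module.End 𝕜 (ℕ → 𝕜) := Psi * intP * PsiInv

/-! ### Sequence spaces and invertibility on them -/

/-- The space `ℓ¹`. -/
def ellOne : Set (ℕ → 𝕜) := {v | Summable fun k => ‖v k‖}

/-- The norm of `ℓ¹`. -/
def ellOneNorm (v : ℕ → 𝕜) : ℝ := ∑' k, ‖v k‖

/-- The weighted space `ℓ²_λ`. -/
def ellTwo (lam : ℝ) : Set (ℕ → 𝕜) :=
  {v | Summable fun k : ℕ => ((k : ℝ) + 1) ^ (2 * lam) * ‖v k‖ ^ 2}

/-- The norm of `ℓ²_λ`: the square root of `∑ₖ (k+1)^{2λ} |vₖ|²`. -/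
def ellTwoNorm (lam : ℝ) (v : ℕ → 𝕜) : ℝ := √(∑' k : ℕ, ((k : ℝ) + 1) ^ (2 * lam) * ‖v k‖ ^ 2)

/-- The infinite matrix `A` is invertible on the sequence space `X` with norm `N`: it restricts to
a bounded bijection of `X` onto itself with bounded inverse. -/
structure IsInvertibleOn (X : Set (ℕ → 𝕜)) (N : (ℕ → 𝕜) → ℝ) (A : Module.End 𝕜 (ℕ → 𝕜)) :
    Prop where
  bijOn : BijOn A X X
  bounded : ∃ C : ℝ, ∀ v ∈ X, N (A v) ≤ C * N v
  inverse_bounded : ∃ C : ℝ, ∀ v ∈ X, N v ≤ C * N (A v)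

/-- The right-hand side `e(x) + √(1+x) f(x)`, where `e(x) = ∑ₙ eₙ Pₙ(x)`, `f(x) = ∑ₙ fₙ Uₙ(x)`. -/
def rhsFun (e f : ℕ → 𝕜) (x : ℝ) : 𝕜 := legendreSeries e x + √(1 + x) • chebSeries f x

/-- The reconstructed function `a(x) + √(1+x) b(x)`, where `a(x) = ∑ₙ aₙ Pₙ(x)` and
`b(x) = σ⁻¹ (f(x) - ∑ₙ (Q_P^{1/2} a)ₙ Uₙ(x))`. -/
def solFun (σ : 𝕜) (a f : ℕ → 𝕜) (x : ℝ) : 𝕜 :=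
  legendreSeries a x + √(1 + x) • (σ⁻¹ * (chebSeries f x - chebSeries (halfP a) x))

end Sequences

end HalfInt

end

namespace HalfInt

/-! ### Legendre polynomials -/

/-! The half-integral swaps two families: it sends `Pₙ` to `2/(√π(2n+1)) √(1+x) (Uₙ - Uₙ₋₁)`
(`halfInt_legendreP`) and `√(1+x) Uₙ` to `√π/2 (Pₙ + Pₙ₊₁)` (`halfInt_sqrtChebU`). For `u = a +
√(1+x) b` the equation therefore splits into `σa + halfU b = e` and `halfP a + σb = f`. Eliminating
`b` leaves the Schur complement equation for `a`, and `half_integral_equation` reverses the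
elimination.

Invertibility of the matrices needs only `σ ≠ 0`, which holds because the half-integral itself is
not invertible (`not_isUnit_halfIntL2`). The normalized integration matrix is tridiagonal with
entries tending to zero, also after conjugation by the weights of `ℓ²_λ`, hence compact. By the
Fredholm alternative (`exists_equiv_of_tridiagonal`) it remains to exclude eigenvectors for `μ =
±σ²`. An eigenvector gives a null solution of a three-term recurrence that is also solved by the
bounded Legendre moments of `e^{x/μ}`. The Casoratian of the two solutions has constant modulus and
tends to zero, so it vanishes; its initial value is a nonzero multiple of the first entry, so the
eigenvector is zero (`eq_zero_of_recurrence`). This is the discrete form of the fact that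
integration from `-1` has no nonzero eigenvalue.

For `ℓ¹` coefficients, `|Pₙ| ≤ 1` and `|Uₙ| √(1-x²) ≤ 1` give absolute convergence on `(-1,1)`, and
dominated convergence lets the half-integral act term by term. The same bounds give only `u =
O((1-x)^{-1/2})`, which just misses `L²`. The half-integral of such a function is `O((1-x)^{-1/4})`
(`norm_halfInt_le`), hence always in `L²`; so `σu` and `g` differ by an `L²` function, and one is in
`L²` exactly when the other is. -/

open Polynomial in
/-- The Legendre polynomials as elements of `ℝ[X]`. -/
noncomputable def legendrePoly : ℕ → Polynomial ℝ
  | 0 => 1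
  | 1 => X
  | n + 2 => C ((n : ℝ) + 2)⁻¹ *
      (C (2 * (n : ℝ) + 3) * X * legendrePoly (n + 1) - C ((n : ℝ) + 1) * legendrePoly n)

lemma eval_legendrePoly (x : ℝ) : ∀ n, (legendrePoly n).eval x = legendreP n x
  | 0 => by simp [legendrePoly, legendreP]
  | 1 => by simp [legendrePoly, legendreP]
  | n + 2 => by
    rw [legendrePoly, legendreP]
    simp [eval_legendrePoly x n, eval_legendrePoly x (n + 1)]
    ring

lemma continuous_legendreP (n : ℕ) : Continuous (legendreP n) := by
  have : legendreP n = fun x => (legendrePoly n).eval x :=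
    funext fun x => (eval_legendrePoly x n).symm
  rw [this]
  exact (legendrePoly n).continuous

/-- The derivative of a Legendre polynomial. -/
noncomputable def legendreP' (n : ℕ) (x : ℝ) : ℝ := (legendrePoly n).derivative.eval x

lemma hasDerivAt_legendreP (n : ℕ) (x : ℝ) : HasDerivAt (legendreP n) (legendreP' n x) x := by
  have : legendreP n = fun x => (legendrePoly n).eval x :=
    funext fun x => (eval_legendrePoly x n).symm
  rw [this]
  exact (legendrePoly n).hasDerivAt x

lemma legendreP_recurrence (n : ℕ) (x : ℝ) :
    ((n : ℝ) + 2) * legendreP (n + 2) x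
      = (2 * (n : ℝ) + 3) * x * legendreP (n + 1) x - ((n : ℝ) + 1) * legendreP n x := by
  rw [legendreP]
  field_simp

lemma legendreP'_recurrence (n : ℕ) (x : ℝ) :
    ((n : ℝ) + 2) * legendreP' (n + 2) x
      = (2 * (n : ℝ) + 3) * (legendreP (n + 1) x + x * legendreP' (n + 1) x)
        - ((n : ℝ) + 1) * legendreP' n x := by
  have h := (hasDerivAt_legendreP (n + 2) x).const_mul ((n : ℝ) + 2)
  have h2 := ((((hasDerivAt_id x).const_mul (2 * (n : ℝ) + 3)).mul
    (hasDerivAt_legendreP (n + 1) x))).sub ((hasDerivAt_legendreP n x).const_mul ((n : ℝ) + 1))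
  have e := h.unique (h2.congr_of_eventuallyEq
    (Filter.Eventually.of_forall fun y => legendreP_recurrence n y))
  rw [e]
  simp
  ring

lemma legendreP'_zero (x : ℝ) : legendreP' 0 x = 0 := by simp [legendreP', legendrePoly]

lemma legendreP'_one (x : ℝ) : legendreP' 1 x = 1 := by simp [legendreP', legendrePoly]

/-- The two identities must be proved together: the differentiated recurrence and the second
identity at `n` give the first at `n + 1`, from which the undifferentiated recurrence gives the
second at `n + 1`. -/
lemma legendreP'_relations (x : ℝ) : ∀ n : ℕ,
    legendreP' (n + 1) x = x * legendreP' n x + ((n : ℝ) + 1) * legendreP n x ∧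
    x * legendreP' (n + 1) x - legendreP' n x = ((n : ℝ) + 1) * legendreP (n + 1) x
  | 0 => by simp [legendreP'_zero, legendreP'_one, legendreP]
  | n + 1 => by
    obtain ⟨hA, hB⟩ := legendreP'_relations x n
    have hr := legendreP_recurrence n x
    have hr' := legendreP'_recurrence n x
    have hn : (n : ℝ) + 2 ≠ 0 := by positivity
    have hA' : legendreP' (n + 2) x
        = x * legendreP' (n + 1) x + ((n : ℝ) + 2) * legendreP (n + 1) x := by
      apply mul_left_cancel₀ hn
      linear_combination hr' + ((n : ℝ) + 1) * hB
    refine ⟨by push_cast; linear_combination hA', ?_⟩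
    push_cast
    change x * legendreP' (n + 2) x - legendreP' (n + 1) x = _ * legendreP (n + 2) x
    linear_combination x * hA' - hr - hA + x * hB

lemma legendreP'_sub (n : ℕ) (x : ℝ) :
    legendreP' (n + 2) x - legendreP' n x = (2 * (n : ℝ) + 3) * legendreP (n + 1) x := by
  have h1 := (legendreP'_relations x (n + 1)).1
  have h2 := (legendreP'_relations x n).2
  push_cast at h1
  linear_combination h1 + h2

lemma legendreP_at_one : ∀ n, legendreP n 1 = 1
  | 0 => by simp [legendreP]
  | 1 => by simp [legendreP]
  | n + 2 => by
    rw [legendreP, legendreP_at_one n, legendreP_at_one (n + 1)]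
    field_simp
    ring

lemma legendreP_at_neg_one : ∀ n, legendreP n (-1) = (-1) ^ n
  | 0 => by simp [legendreP]
  | 1 => by simp [legendreP]
  | n + 2 => by
    rw [legendreP, legendreP_at_neg_one n, legendreP_at_neg_one (n + 1)]
    field_simp
    ring

lemma hasDerivAt_sturmLiouville (n : ℕ) (x : ℝ) :
    HasDerivAt (fun x => (1 - x ^ 2) * legendreP' n x)
      (-((n : ℝ) * (n + 1)) * legendreP n x) x := by
  -- Rewritten without derivatives, the flux can be differentiated using first derivatives only.
  have e : (fun x => (1 - x ^ 2) * legendreP' n x)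
      = fun x => ((n : ℝ) + 1) * (x * legendreP n x - legendreP (n + 1) x) := by
    funext x
    obtain ⟨hA, hB⟩ := legendreP'_relations x n
    linear_combination -hB + x * hA
  rw [e]
  have h := (((hasDerivAt_id x).mul (hasDerivAt_legendreP n x)).sub
    (hasDerivAt_legendreP (n + 1) x)).const_mul ((n : ℝ) + 1)
  convert! h using 1
  simp only [id]
  linear_combination ((n : ℝ) + 1) * (legendreP'_relations x n).1

/-- Sonin's argument: by the Legendre equation, `f = n(n+1) Pₙ² + (1-x²) Pₙ'²` has derivative `2x
Pₙ'²`, so on `[-1,1]` it is largest at the endpoints, where it equals `n(n+1)`. The case `n = 0` is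
separate because the factor `n(n+1)` vanishes. -/
lemma abs_legendreP_le_one (n : ℕ) {x : ℝ} (hx : x ∈ Icc (-1 : ℝ) 1) : |legendreP n x| ≤ 1 := by
  rcases Nat.eq_zero_or_pos n with rfl | hn
  · simp [legendreP]
  have hn' : (0 : ℝ) < n := by exact_mod_cast hn
  have hN : (0 : ℝ) < (n : ℝ) * (n + 1) := by positivity
  set f : ℝ → ℝ := fun x => (n : ℝ) * (n + 1) * legendreP n x ^ 2
    + ((1 - x ^ 2) * legendreP' n x) * legendreP' n x with hf
  have hd' : ∀ y, HasDerivAt (legendreP' n) ((legendrePoly n).derivative.derivative.eval y) y :=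
    fun y => (legendrePoly n).derivative.hasDerivAt y
  have hode : ∀ y, (1 - y ^ 2) * (legendrePoly n).derivative.derivative.eval y
      = 2 * y * legendreP' n y - (n : ℝ) * (n + 1) * legendreP n y := by
    intro y
    have h1 : HasDerivAt (fun y : ℝ => 1 - y ^ 2) (-(2 * y)) y := by
      simpa using ((hasDerivAt_id y).pow 2).const_sub 1
    have := (h1.mul (hd' y)).unique (hasDerivAt_sturmLiouville n y)
    linear_combination this
  have hfd : ∀ y, HasDerivAt f (2 * y * legendreP' n y ^ 2) y := by
    intro y
    have h := (((hasDerivAt_legendreP n y).pow 2).const_mul ((n : ℝ) * (n + 1))).add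
      ((hasDerivAt_sturmLiouville n y).mul (hd' y))
    convert! h using 1
    simp only [Nat.cast_ofNat, Nat.add_one_sub_one, pow_one]
    linear_combination -(legendreP' n y) * hode y
  have hfc : Continuous f := continuous_iff_continuousAt.2 fun y => (hfd y).continuousAt
  have hf1 : f 1 = (n : ℝ) * (n + 1) := by simp [hf, legendreP_at_one]
  have hf2 : f (-1) = (n : ℝ) * (n + 1) := by
    simp [hf, legendreP_at_neg_one, ← pow_mul, mul_comm n 2]
  have hfle : f x ≤ (n : ℝ) * (n + 1) := by
    rcases le_total 0 x with h0 | h0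
    · have hm : MonotoneOn f (Icc 0 1) := by
        refine monotoneOn_of_hasDerivWithinAt_nonneg (convex_Icc _ _) hfc.continuousOn
          (fun y _ => (hfd y).hasDerivWithinAt) fun y hy => ?_
        rw [interior_Icc] at hy
        have := hy.1
        positivity
      rw [← hf1]
      exact hm ⟨h0, hx.2⟩ ⟨zero_le_one, le_rfl⟩ hx.2
    · have hm : AntitoneOn f (Icc (-1) 0) := by
        refine antitoneOn_of_hasDerivWithinAt_nonpos (convex_Icc _ _) hfc.continuousOn
          (fun y _ => (hfd y).hasDerivWithinAt) fun y hy => ?_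
        rw [interior_Icc] at hy
        have := hy.2
        nlinarith [sq_nonneg (legendreP' n y)]
      rw [← hf2]
      exact hm ⟨le_rfl, by norm_num⟩ ⟨hx.1, h0⟩ hx.1
  have h3 : 0 ≤ ((1 - x ^ 2) * legendreP' n x) * legendreP' n x := by
    have : 0 ≤ 1 - x ^ 2 := by nlinarith [hx.1, hx.2]
    nlinarith [mul_nonneg this (sq_nonneg (legendreP' n x))]
  rw [← sq_le_one_iff_abs_le_one]
  have : (n : ℝ) * (n + 1) * legendreP n x ^ 2 ≤ (n : ℝ) * (n + 1) := by
    simp only [hf] at hfle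
    linarith
  nlinarith

/-! ### Chebyshev polynomials of the second kind -/

lemma continuous_chebU (n : ℕ) : Continuous (chebU n) := Polynomial.continuous _

lemma chebU_zero (x : ℝ) : chebU 0 x = 1 := by simp [chebU]

lemma chebU_one (x : ℝ) : chebU 1 x = 2 * x := by simp [chebU]

lemma chebU_add_two (n : ℕ) (x : ℝ) :
    chebU (n + 2) x = 2 * x * chebU (n + 1) x - chebU n x := by
  simp [chebU, Polynomial.Chebyshev.U_add_two]

lemma abs_chebU_mul_le {n : ℕ} {x : ℝ} (hx : x ∈ Icc (-1 : ℝ) 1) :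
    |chebU n x| * √(1 - x ^ 2) ≤ 1 := by
  have h := Polynomial.Chebyshev.U_real_cos (Real.arccos x) n
  rw [Real.cos_arccos hx.1 hx.2, Real.sin_arccos] at h
  rw [← abs_of_nonneg (Real.sqrt_nonneg (1 - x ^ 2)), ← abs_mul, chebU, h]
  exact Real.abs_sin_le_one _

lemma abs_sin_nat_mul_le (n : ℕ) (θ : ℝ) : |Real.sin (n * θ)| ≤ n * |Real.sin θ| := by
  induction n with
  | zero => simp
  | succ n ih =>
    push_cast
    rw [add_mul, one_mul, Real.sin_add]
    calc |Real.sin (n * θ) * Real.cos θ + Real.cos (n * θ) * Real.sin θ|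
        ≤ |Real.sin (n * θ)| * |Real.cos θ| + |Real.cos (n * θ)| * |Real.sin θ| := by
          rw [← abs_mul, ← abs_mul]
          exact abs_add_le _ _
      _ ≤ |Real.sin (n * θ)| * 1 + 1 * |Real.sin θ| := by
          gcongr
          · exact Real.abs_cos_le_one _
          · exact Real.abs_cos_le_one _
      _ ≤ (n + 1) * |Real.sin θ| := by linarith

/-- With `x = cos θ`, divide `|sin((n+1)θ)| ≤ (n+1)|sin θ|` by `sin θ`, which is positive on the
open interval. -/
lemma abs_chebU_le (n : ℕ) {x : ℝ} (hx : x ∈ Ioo (-1 : ℝ) 1) : |chebU n x| ≤ n + 1 := by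
  have h := Polynomial.Chebyshev.U_real_cos (Real.arccos x) n
  have hs := abs_sin_nat_mul_le (n + 1) (Real.arccos x)
  push_cast at hs h
  rw [← h, abs_mul, Real.cos_arccos hx.1.le hx.2.le, Real.sin_arccos] at hs
  have hp : 0 < √(1 - x ^ 2) := Real.sqrt_pos.2 (by nlinarith [hx.1, hx.2])
  rw [abs_of_pos hp] at hs
  exact le_of_mul_le_mul_right hs hp

/-! ### The Legendre integration matrix has no nonzero eigenvalue -/

section Eigenvector

variable {𝕜 : Type*} [RCLike 𝕜]

/-- The exponential `x ↦ e^{sx}`. -/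
noncomputable def expAt (s : 𝕜) (x : ℝ) : 𝕜 := NormedSpace.exp (x • s)

lemma hasDerivAt_expAt (s : 𝕜) (x : ℝ) : HasDerivAt (expAt s) (s * expAt s x) x := by
  rw [mul_comm]
  exact hasDerivAt_exp_smul_const (𝕂 := ℝ) s x

lemma continuous_expAt (s : 𝕜) : Continuous (expAt s) :=
  continuous_iff_continuousAt.2 fun x => (hasDerivAt_expAt s x).continuousAt

lemma expAt_ne_zero (s : 𝕜) (x : ℝ) : expAt s x ≠ 0 := by
  let : NormedAlgebra ℚ 𝕜 := NormedAlgebra.restrictScalars ℚ ℝ 𝕜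
  exact (NormedSpace.isUnit_exp (x • s)).ne_zero

/-- The Legendre moments of `e^{sx}`. -/
noncomputable def expMoment (s : 𝕜) (n : ℕ) : 𝕜 :=
  ∫ x in (-1 : ℝ)..1, legendreP n x • expAt s x

lemma continuous_legendreP' (n : ℕ) : Continuous (legendreP' n) := Polynomial.continuous _

lemma integral_legendreP'_smul_expAt (s : 𝕜) (n : ℕ) :
    ∫ x in (-1 : ℝ)..1, legendreP' n x • expAt s x
      = expAt s 1 - (-1 : 𝕜) ^ n * expAt s (-1) - s * expMoment s n := by
  have hc := continuous_expAt s
  have hP := continuous_legendreP n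
  have hP' := continuous_legendreP' n
  have h1 : ∀ x, HasDerivAt (fun x => legendreP n x • expAt s x)
      (legendreP n x • (s * expAt s x) + legendreP' n x • expAt s x) x :=
    fun x => (hasDerivAt_legendreP n x).smul (hasDerivAt_expAt s x)
  have h2 := intervalIntegral.integral_eq_sub_of_hasDerivAt (a := -1) (b := 1) (fun x _ => h1 x)
    (Continuous.intervalIntegrable (by fun_prop) _ _)
  rw [intervalIntegral.integral_add (Continuous.intervalIntegrable (by fun_prop) _ _)
    (Continuous.intervalIntegrable (by fun_prop) _ _)] at h2
  have h3 : ∫ x in (-1 : ℝ)..1, legendreP n x • (s * expAt s x) = s * expMoment s n := by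
    rw [expMoment, ← intervalIntegral.integral_const_mul]
    exact intervalIntegral.integral_congr fun x _ => (mul_smul_comm _ _ _).symm
  rw [h3, legendreP_at_one, legendreP_at_neg_one, one_smul] at h2
  have h4 : ((-1 : ℝ) ^ n) • expAt s (-1) = (-1 : 𝕜) ^ n * expAt s (-1) := by
    rw [RCLike.real_smul_eq_coe_mul]
    push_cast
    rfl
  rw [h4] at h2
  linear_combination h2

/-- Integrate `P'ₙ₊₂ - P'ₙ = (2n+3) Pₙ₊₁` against `e^{sx}`; the boundary terms of the two
integrations by parts cancel because `n` and `n + 2` have the same parity. -/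
lemma expMoment_recurrence {s μ : 𝕜} (h : μ * s = 1) (n : ℕ) :
    expMoment s n - expMoment s (n + 2) = μ * (2 * (n : 𝕜) + 3) * expMoment s (n + 1) := by
  have hc := continuous_expAt s
  have h1 : ∫ x in (-1 : ℝ)..1, legendreP' (n + 2) x • expAt s x
      = (2 * (n : 𝕜) + 3) * expMoment s (n + 1)
        + ∫ x in (-1 : ℝ)..1, legendreP' n x • expAt s x := by
    have hP := continuous_legendreP (n + 1)
    have hP' := continuous_legendreP' n
    rw [expMoment, ← intervalIntegral.integral_const_mul, ← intervalIntegral.integral_add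
      (Continuous.intervalIntegrable (by fun_prop) _ _)
      (Continuous.intervalIntegrable (by fun_prop) _ _)]
    refine intervalIntegral.integral_congr fun x _ => ?_
    have := legendreP'_sub n x
    rw [show legendreP' (n + 2) x = (2 * (n : ℝ) + 3) * legendreP (n + 1) x + legendreP' n x by
      linear_combination this]
    simp only [RCLike.real_smul_eq_coe_mul]
    push_cast
    ring
  rw [integral_legendreP'_smul_expAt, integral_legendreP'_smul_expAt, pow_add] at h1
  linear_combination μ * h1 - (expMoment s n - expMoment s (n + 2)) * h

/-- In the first row the boundary terms at `-1` add up instead of cancelling. This defect is what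
distinguishes the moments from an eigenvector. -/
lemma expMoment_initial {s μ : 𝕜} (h : μ * s = 1) :
    (1 - μ) * expMoment s 0 - expMoment s 1 = -2 * μ * expAt s (-1) := by
  have h0 := integral_legendreP'_smul_expAt s 0
  have h1 := integral_legendreP'_smul_expAt s 1
  have h2 : ∫ x in (-1 : ℝ)..1, legendreP' 1 x • expAt s x = expMoment s 0 := by
    simp [expMoment, legendreP, legendreP'_one]
  rw [h2] at h1
  simp only [legendreP'_zero, zero_smul, intervalIntegral.integral_zero, pow_zero] at h0
  simp only [pow_one] at h1
  linear_combination μ * h0 - μ * h1 - (expMoment s 0 - expMoment s 1) * h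

lemma exists_norm_expMoment_le (s : 𝕜) : ∃ C, ∀ n, ‖expMoment s n‖ ≤ C := by
  obtain ⟨C, hC⟩ := (isCompact_Icc (a := (-1 : ℝ)) (b := 1)).exists_bound_of_continuousOn
    (continuous_expAt s).continuousOn
  refine ⟨C * |1 - (-1)|, fun n => intervalIntegral.norm_integral_le_of_norm_le_const fun x hx => ?_⟩
  rw [uIoc_of_le (by norm_num)] at hx
  have hx' : x ∈ Icc (-1 : ℝ) 1 := Ioc_subset_Icc_self hx
  rw [norm_smul, Real.norm_eq_abs]
  calc _ ≤ 1 * ‖expAt s x‖ := by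
        gcongr
        exact abs_legendreP_le_one n hx'
    _ ≤ C := by rw [one_mul]; exact hC x hx'

/-- A null sequence satisfying the three-term recurrence of an eigenvector of the Legendre
integration matrix vanishes. -/
lemma eq_zero_of_recurrence {μ : 𝕜} (hμ : μ ≠ 0) {α : ℕ → 𝕜}
    (hα : Filter.Tendsto α Filter.atTop (nhds 0)) (h0 : α 0 - α 1 = μ * α 0)
    (h1 : ∀ n : ℕ, α n - α (n + 2) = μ * (2 * (n : 𝕜) + 3) * α (n + 1)) : α = 0 := by
  have hs : μ * μ⁻¹ = 1 := mul_inv_cancel₀ hμ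
  set G := expMoment μ⁻¹ with hG
  -- The Casoratian (discrete Wronskian) of the two solutions; each step of the recurrence only
  -- flips its sign.
  set W : ℕ → 𝕜 := fun n => α (n + 1) * G n - α n * G (n + 1) with hW
  have hstep : ∀ n, W (n + 1) = -W n := by
    intro n
    have := expMoment_recurrence hs n
    simp only [hW]
    linear_combination (-G (n + 1)) * h1 n + α (n + 1) * this
  have hnorm : ∀ n, ‖W n‖ = ‖W 0‖ := by
    intro n
    induction n with
    | zero => rfl
    | succ n ih => rw [hstep, norm_neg, ih]
  obtain ⟨C, hC⟩ := exists_norm_expMoment_le (μ⁻¹ : 𝕜)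
  have hlim : Filter.Tendsto W Filter.atTop (nhds 0) := by
    have hb : ∀ k, Filter.IsBoundedUnder (· ≤ ·) Filter.atTop (fun n => ‖G (n + k)‖) :=
      fun k => Filter.isBoundedUnder_of ⟨C, fun n => hC (n + k)⟩
    have hα1 : Filter.Tendsto (fun n => α (n + 1)) Filter.atTop (nhds 0) :=
      hα.comp (Filter.tendsto_add_atTop_nat 1)
    simpa using (hα1.zero_mul_isBoundedUnder_le (hb 0)).sub (hα.zero_mul_isBoundedUnder_le (hb 1))
  have hW0 : W 0 = 0 := by
    have h2 := hlim.norm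
    simp only [hnorm, norm_zero] at h2
    exact norm_eq_zero.1 (tendsto_nhds_unique tendsto_const_nhds h2)
  have hα0 : α 0 = 0 := by
    have h2 := expMoment_initial hs
    -- The first row gives `α 1 = (1 - μ) α 0`, so `W 0` is `α 0` times the defect in
    -- `expMoment_initial`.
    have h3 : α 0 * (-2 * μ * expAt μ⁻¹ (-1)) = 0 := by
      rw [← h2, ← hW0]
      simp only [hW]
      linear_combination G 0 * h0
    have h4 : (-2 * μ * expAt μ⁻¹ (-1) : 𝕜) ≠ 0 :=
      mul_ne_zero (mul_ne_zero (by norm_num) hμ) (expAt_ne_zero _ _)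
    exact (mul_eq_zero.1 h3).resolve_right h4
  have hα1 : α 1 = 0 := by linear_combination -h0 + (1 - μ) * hα0
  have : ∀ n, α n = 0 ∧ α (n + 1) = 0 := by
    intro n
    induction n with
    | zero => exact ⟨hα0, hα1⟩
    | succ n ih => exact ⟨ih.2, by linear_combination ih.1 - h1 n - μ * (2 * (n : 𝕜) + 3) * ih.2⟩
  exact funext fun n => (this n).1

/-! ### The scaling `Ψ` and the entries of the integration matrix -/

lemma psi_pos (n : ℕ) : 0 < psi n := Real.sqrt_pos.2 (by positivity)

lemma psi_sq (n : ℕ) : psi n ^ 2 = 2 / (2 * (n : ℝ) + 1) := Real.sq_sqrt (by positivity)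

lemma psi_anti {m n : ℕ} (h : m ≤ n) : psi n ≤ psi m := by
  unfold psi
  have : (m : ℝ) ≤ n := by exact_mod_cast h
  gcongr

lemma psi_le_two_mul (n : ℕ) : psi n ≤ 2 * psi (n + 1) := by
  have h1 := psi_sq n
  have h2 := psi_sq (n + 1)
  refine le_of_sq_le_sq ?_ (by linarith [psi_pos (n + 1)])
  rw [mul_pow, h1, h2]
  push_cast
  rw [← mul_div_assoc, div_le_div_iff₀ (by positivity) (by positivity)]
  have : (0 : ℝ) ≤ n := Nat.cast_nonneg n
  nlinarith

/-- The inverse scaling grows only like `√n`, so the factor `1/(2n+1)` gained by integration absorbs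
it. -/
lemma inv_psi_div_le (n : ℕ) : (psi n)⁻¹ / (2 * (n : ℝ) + 1) ≤ 1 := by
  have h1 := psi_sq n
  have hp := psi_pos n
  have hn : (0 : ℝ) ≤ n := Nat.cast_nonneg n
  rw [div_le_one (by positivity), inv_le_comm₀ hp (by positivity)]
  refine le_of_sq_le_sq ?_ hp.le
  rw [h1, inv_pow, inv_eq_one_div, div_le_div_iff₀ (by positivity) (by positivity)]
  nlinarith

lemma intP_apply_zero (a : ℕ → 𝕜) : intP a 0 = a 0 - (1 / 3 : ℝ) • a 1 := by
  have hpi : (√Real.pi) ≠ 0 := (Real.sqrt_pos.2 Real.pi_pos).ne'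
  simp only [intP, halfU, halfP, Module.End.mul_apply, LinearMap.coe_mk, AddHom.coe_mk, if_true,
    add_zero, smul_smul]
  rw [show √Real.pi / 2 * (2 / √Real.pi) = 1 by field_simp]
  norm_num

lemma intP_apply_succ (a : ℕ → 𝕜) (n : ℕ) :
    intP a (n + 1) = (1 / (2 * (n : ℝ) + 1)) • a n - (1 / (2 * (n : ℝ) + 5)) • a (n + 2) := by
  have hpi : (√Real.pi) ≠ 0 := (Real.sqrt_pos.2 Real.pi_pos).ne'
  simp only [intP, halfU, halfP, Module.End.mul_apply, LinearMap.coe_mk, AddHom.coe_mk,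
    Nat.succ_ne_zero, if_false, ← smul_add, smul_smul, Nat.add_sub_cancel]
  rw [show √Real.pi / 2 * (2 / √Real.pi) = 1 by field_simp, one_smul]
  push_cast
  rw [show 2 * ((n : ℝ) + 1) + 1 = 2 * n + 3 by ring,
    show 2 * ((n : ℝ) + 1) + 3 = 2 * n + 5 by ring]
  abel

lemma intPNormalized_apply (v : ℕ → 𝕜) (n : ℕ) :
    intPNormalized v n = psi n • intP (PsiInv v) n := rfl

lemma PsiInv_apply (v : ℕ → 𝕜) (n : ℕ) : PsiInv v n = (psi n)⁻¹ • v n := rfl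

lemma Psi_apply (v : ℕ → 𝕜) (n : ℕ) : Psi v n = psi n • v n := rfl

lemma PsiInv_Psi (v : ℕ → 𝕜) : PsiInv (Psi v) = v := by
  funext n
  rw [PsiInv_apply, Psi_apply, inv_smul_smul₀ (psi_pos n).ne']

lemma Psi_PsiInv (v : ℕ → 𝕜) : Psi (PsiInv v) = v := by
  funext n
  rw [Psi_apply, PsiInv_apply, smul_inv_smul₀ (psi_pos n).ne']

lemma intPNormalized_Psi (a : ℕ → 𝕜) : intPNormalized (Psi a) = Psi (intP a) := by
  change Psi (intP (PsiInv (Psi a))) = _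
  rw [PsiInv_Psi]

/-- The normalized Legendre integration matrix has no eigenvector that tends to zero for a nonzero
eigenvalue. -/
lemma eq_zero_of_intPNormalized_eq {μ : 𝕜} (hμ : μ ≠ 0) {v : ℕ → 𝕜}
    (hv : Filter.Tendsto v Filter.atTop (nhds 0)) (h : intPNormalized v = μ • v) : v = 0 := by
  set a := PsiInv v with ha
  have hva : v = Psi a := (Psi_PsiInv v).symm
  have h' : intP a = μ • a := by
    have h2 : Psi (intP a) = Psi (μ • a) := by rw [← intPNormalized_Psi, ← hva, h, map_smul, ← hva]
    rw [← PsiInv_Psi (intP a), h2, PsiInv_Psi]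
  -- Division by `2n + 1` turns the eigenvalue equation into the recurrence of the moments, and also
  -- makes the sequence null although `a` need not be.
  set α : ℕ → 𝕜 := fun n => (1 / (2 * (n : ℝ) + 1)) • a n with hα
  have hd : ∀ n, a n = (2 * (n : 𝕜) + 1) * α n := by
    intro n
    have hn : (2 * (n : ℝ) + 1) ≠ 0 := by positivity
    have : a n = (2 * (n : ℝ) + 1) • α n := by
      simp only [hα, smul_smul]
      rw [mul_one_div_cancel hn, one_smul]
    rw [this, RCLike.real_smul_eq_coe_mul]
    push_cast
    rfl
  have hlim : Filter.Tendsto α Filter.atTop (nhds 0) := by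
    refine squeeze_zero_norm (fun n => ?_) (by simpa using hv.norm)
    have : α n = ((psi n)⁻¹ / (2 * (n : ℝ) + 1)) • v n := by
      simp only [hα, ha, PsiInv_apply, smul_smul]
      congr 1
      ring
    have hp := psi_pos n
    rw [this, norm_smul, Real.norm_of_nonneg (by positivity)]
    exact mul_le_of_le_one_left (norm_nonneg _) (inv_psi_div_le n)
  have hz : α = 0 := by
    refine eq_zero_of_recurrence hμ hlim ?_ fun n => ?_
    · have h0 := congrFun h' 0
      rw [intP_apply_zero, Pi.smul_apply, smul_eq_mul] at h0
      have e0 : α 0 = a 0 := by simp [hα]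
      have e1 : α 1 = (1 / 3 : ℝ) • a 1 := by simp only [hα]; norm_num
      rw [e0, e1, h0]
    · have h1 := congrFun h' (n + 1)
      rw [intP_apply_succ, Pi.smul_apply, smul_eq_mul, hd (n + 1)] at h1
      have e2 : α (n + 2) = (1 / (2 * (n : ℝ) + 5)) • a (n + 2) := by
        simp only [hα]
        push_cast
        congr 2
        ring
      rw [e2]
      push_cast at h1
      linear_combination h1
  funext n
  rw [hva, Psi_apply, hd n, hz]
  simp

end Eigenvector

/-! ### Compact perturbations of scalar operators on `ℓ^p` -/

section SequenceOperators

variable {𝕜 : Type*} [RCLike 𝕜] {p : ℝ≥0∞} [Fact (1 ≤ p)]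

/-- Composition with `φ` at most doubles sums of nonnegative terms. -/
def DoublesSums (φ : ℕ → ℕ) : Prop :=
  ∀ f : ℕ → ℝ, (∀ n, 0 ≤ f n) → Summable f →
    Summable (fun n => f (φ n)) ∧ ∑' n, f (φ n) ≤ 2 * ∑' n, f n

lemma doublesSums_succ : DoublesSums (fun n => n + 1) := by
  intro f hf hs
  have h1 : Summable fun n => f (n + 1) := (summable_nat_add_iff 1).2 hs
  refine ⟨h1, ?_⟩
  have h2 := hs.tsum_eq_zero_add
  have h3 : 0 ≤ ∑' n, f n := tsum_nonneg hf
  linarith [hf 0]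

/-- Truncated subtraction visits the index `0` twice; this repeated term is where the factor `2`
comes from. -/
lemma doublesSums_pred : DoublesSums (fun n => n - 1) := by
  intro f hf hs
  have h1 : Summable fun n => f (n - 1) := (summable_nat_add_iff 1).1 (by simpa using hs)
  refine ⟨h1, ?_⟩
  have h2 := h1.tsum_eq_zero_add
  simp only [Nat.zero_sub, Nat.add_sub_cancel] at h2
  have h3 := hs.le_tsum 0 fun n _ => hf n
  linarith

lemma toReal_pos_of_ne_top (hp : p ≠ ∞) : 0 < p.toReal :=
  ENNReal.toReal_pos (zero_lt_one.trans_le (Fact.out : 1 ≤ p)).ne' hp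

lemma one_le_toReal (hp : p ≠ ∞) : 1 ≤ p.toReal := by
  simpa using ENNReal.toReal_mono hp (Fact.out : 1 ≤ p)

lemma rpow_norm_le_of_norm_le {a b c ε q : ℝ} (hb : 0 ≤ b) (ha : 0 ≤ a) (hq : 0 ≤ q)
    (hε : 0 ≤ ε) (h : a ≤ ε * b) (hc : c = b ^ q) : a ^ q ≤ ε ^ q * c := by
  rw [hc, ← Real.mul_rpow hε hb]
  gcongr

lemma memlp_of_norm_le (hp : p ≠ ∞) {φ : ℕ → ℕ} (hφ : DoublesSums φ) {u v : ℕ → 𝕜} {ε : ℝ}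
    (hε : 0 ≤ ε) (hv : Memℓp v p) (h : ∀ n, ‖u n‖ ≤ ε * ‖v (φ n)‖) : Memℓp u p := by
  have hp0 := toReal_pos_of_ne_top hp
  refine memℓp_gen (Summable.of_nonneg_of_le (fun n => by positivity)
    (fun n => rpow_norm_le_of_norm_le (norm_nonneg (v (φ n))) (norm_nonneg _) hp0.le hε (h n) rfl)
    ((hφ (fun n => ‖v n‖ ^ p.toReal) (fun n => by positivity) (hv.summable hp0)).1.mul_left _))

lemma lp_norm_le_of_norm_le (hp : p ≠ ∞) {φ : ℕ → ℕ} (hφ : DoublesSums φ)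
    {u v : lp (fun _ : ℕ => 𝕜) p} {ε : ℝ}
    (hε : 0 ≤ ε) (h : ∀ n, ‖u n‖ ≤ ε * ‖v (φ n)‖) : ‖u‖ ≤ 2 * ε * ‖v‖ := by
  have hp0 := toReal_pos_of_ne_top hp
  have hs := (lp.memℓp v).summable hp0
  obtain ⟨h1, h2⟩ := hφ (fun n => ‖v n‖ ^ p.toReal) (fun n => by positivity) hs
  refine lp.norm_le_of_tsum_le hp0 (by positivity) ?_
  have hle : ∀ n, ‖u n‖ ^ p.toReal ≤ ε ^ p.toReal * ‖v (φ n)‖ ^ p.toReal := fun n =>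
    rpow_norm_le_of_norm_le (norm_nonneg (v (φ n))) (norm_nonneg _) hp0.le hε (h n) rfl
  calc ∑' n, ‖u n‖ ^ p.toReal ≤ ∑' n, ε ^ p.toReal * ‖v (φ n)‖ ^ p.toReal :=
        ((lp.memℓp u).summable hp0).tsum_le_tsum hle (h1.mul_left _)
    _ = ε ^ p.toReal * ∑' n, ‖v (φ n)‖ ^ p.toReal := tsum_mul_left
    _ ≤ ε ^ p.toReal * (2 ^ p.toReal * ‖v‖ ^ p.toReal) := by
        gcongr
        rw [lp.norm_rpow_eq_tsum hp0]
        refine h2.trans ?_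
        gcongr
        -- Since `p ≥ 1`, `2 ≤ 2 ^ p`, so the doubling of the sum costs at most a factor `2` in the
        -- norm.
        exact Real.self_le_rpow_of_one_le one_le_two (one_le_toReal hp)
    _ = (2 * ε * ‖v‖) ^ p.toReal := by
        rw [Real.mul_rpow (by positivity) (by positivity), Real.mul_rpow (by positivity) hε]
        ring

/-- The operator `v ↦ (dₙ v_{φ n})ₙ` on `ℓ^p`. -/
noncomputable def weightedComp (hp : p ≠ ∞) {φ : ℕ → ℕ} (hφ : DoublesSums φ) (d : ℕ → ℝ) (M : ℝ)
    (hd : ∀ n, |d n| ≤ M) : lp (fun _ : ℕ => 𝕜) p →L[𝕜] lp (fun _ : ℕ => 𝕜) p :=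
  have hM : 0 ≤ M := (abs_nonneg _).trans (hd 0)
  have hle : ∀ (v : ℕ → 𝕜) n, ‖d n • v (φ n)‖ ≤ M * ‖v (φ n)‖ := fun v n => by
    rw [norm_smul, Real.norm_eq_abs]
    gcongr
    exact hd n
  LinearMap.mkContinuous
    { toFun := fun v => ⟨fun n => d n • v (φ n), memlp_of_norm_le hp hφ hM (lp.memℓp v) (hle v)⟩
      map_add' := fun u v => by
        ext n
        exact smul_add _ _ _
      map_smul' := fun c v => by
        ext n
        exact smul_comm (d n) c (v (φ n)) }
    (2 * M) (fun v => lp_norm_le_of_norm_le hp hφ hM (hle v))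

lemma weightedComp_apply (hp : p ≠ ∞) {φ : ℕ → ℕ} (hφ : DoublesSums φ) (d : ℕ → ℝ) (M : ℝ)
    (hd : ∀ n, |d n| ≤ M) (v : lp (fun _ : ℕ => 𝕜) p) (n : ℕ) :
    weightedComp hp hφ d M hd v n = d n • v (φ n) := rfl

/-- Keeping only the first `N` rows gives a finite-rank operator, and the error in operator norm is
at most twice the supremum of `|d n|` over `n ≥ N`. -/
lemma isCompactOperator_weightedComp (hp : p ≠ ∞) {φ : ℕ → ℕ} (hφ : DoublesSums φ) (d : ℕ → ℝ)
    (M : ℝ) (hd : ∀ n, |d n| ≤ M) (hlim : Filter.Tendsto d Filter.atTop (nhds 0)) :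
    IsCompactOperator (weightedComp (𝕜 := 𝕜) hp hφ d M hd) := by
  let F : ℕ → lp (fun _ : ℕ => 𝕜) p →L[𝕜] lp (fun _ : ℕ => 𝕜) p := fun N =>
    ∑ k ∈ Finset.range N, (lp.singleContinuousLinearMap 𝕜 (fun _ : ℕ => 𝕜) p k).comp
      (((d k : ℝ) : 𝕜) • lp.evalCLM 𝕜 (fun _ : ℕ => 𝕜) p (φ k))
  have hF : ∀ N, IsCompactOperator (F N) := by
    intro N
    have : F N ∈ compactOperator (RingHom.id 𝕜) (lp (fun _ : ℕ => 𝕜) p)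
        (lp (fun _ : ℕ => 𝕜) p) := by
      refine Submodule.sum_mem _ fun k _ => ?_
      have hk : IsCompactOperator (lp.singleContinuousLinearMap 𝕜 (fun _ : ℕ => 𝕜) p k) :=
        isCompactOperator_of_locallyCompactSpace_rng (M₂ := 𝕜) _
      exact hk.comp_clm (((d k : ℝ) : 𝕜) • lp.evalCLM 𝕜 (fun _ : ℕ => 𝕜) p (φ k))
    exact this
  have hFv : ∀ N (v : lp (fun _ : ℕ => 𝕜) p) n,
      F N v n = if n < N then d n • v (φ n) else 0 := by
    intro N v n
    simp only [F, sum_apply, ContinuousLinearMap.comp_apply,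
      smul_apply, lp.singleContinuousLinearMap_apply, lp.coeFn_sum,
      Finset.sum_apply, lp.single_apply]
    split_ifs with h
    · rw [Finset.sum_eq_single n]
      · rw [Pi.single_eq_same, RCLike.real_smul_eq_coe_mul]
        rfl
      · intro k _ hk
        simp [hk.symm]
      · intro h'
        exact absurd (Finset.mem_range.2 h) h'
    · refine Finset.sum_eq_zero fun k hk => ?_
      have : n ≠ k := by
        rintro rfl
        exact h (Finset.mem_range.1 hk)
      simp [this]
  refine isCompactOperator_of_tendsto (l := Filter.atTop) (F := F) ?_
    (Filter.Eventually.of_forall hF)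
  rw [Metric.tendsto_atTop]
  intro ε hε
  obtain ⟨N, hN⟩ := Metric.tendsto_atTop.1 hlim (ε / 4) (by positivity)
  refine ⟨N, fun m hm => ?_⟩
  rw [dist_eq_norm]
  refine lt_of_le_of_lt (ContinuousLinearMap.opNorm_le_bound _ (by positivity : 0 ≤ 2 * (ε / 4))
    fun v => lp_norm_le_of_norm_le hp hφ (by positivity) fun n => ?_) (by linarith)
  rw [sub_apply, lp.coeFn_sub, Pi.sub_apply, hFv, weightedComp_apply]
  split_ifs with h
  · simp only [sub_self, norm_zero]
    positivity
  · rw [zero_sub, norm_neg, norm_smul]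
    gcongr
    have := hN n (by omega)
    rw [dist_zero_right] at this
    exact this.le

/-- The Fredholm alternative for a tridiagonal matrix whose off-diagonal entries tend to zero. -/
lemma exists_equiv_of_tridiagonal (hp : p ≠ ∞) {γ δ : ℕ → ℝ}
    (hγ : Filter.Tendsto γ Filter.atTop (nhds 0)) (hδ : Filter.Tendsto δ Filter.atTop (nhds 0))
    {μ : 𝕜} (hμ : μ ≠ 0)
    (hinj : ∀ v : ℕ → 𝕜, Memℓp v p → (∀ n, γ n • v (n - 1) + δ n • v (n + 1) = μ * v n) → v = 0) :
    ∃ T : lp (fun _ : ℕ => 𝕜) p ≃L[𝕜] lp (fun _ : ℕ => 𝕜) p,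
      ∀ v n, T v n = γ n • v (n - 1) + δ n • v (n + 1) - μ * v n := by
  obtain ⟨M, hM⟩ := hγ.norm.bddAbove_range
  obtain ⟨M', hM'⟩ := hδ.norm.bddAbove_range
  have hγM : ∀ n, |γ n| ≤ M := fun n => hM ⟨n, rfl⟩
  have hδM : ∀ n, |δ n| ≤ M' := fun n => hM' ⟨n, rfl⟩
  set K : lp (fun _ : ℕ => 𝕜) p →L[𝕜] lp (fun _ : ℕ => 𝕜) p :=
    weightedComp hp doublesSums_pred γ M hγM + weightedComp hp doublesSums_succ δ M' hδM with hK
  have hKc : IsCompactOperator K :=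
    (isCompactOperator_weightedComp hp doublesSums_pred γ M hγM hγ).add
      (isCompactOperator_weightedComp hp doublesSums_succ δ M' hδM hδ)
  have hKv : ∀ v n, K v n = γ n • v (n - 1) + δ n • v (n + 1) := fun v n => rfl
  rcases hKc.hasEigenvalue_or_mem_resolventSet hμ with h | h
  · obtain ⟨v, hv⟩ := h.exists_hasEigenvector
    refine absurd ?_ hv.2
    have hv1 : K v = μ • v := Module.End.mem_eigenspace_iff.1 hv.1
    refine lp.ext (hinj v (lp.memℓp v) fun n => ?_)
    rw [← hKv, hv1]
    rfl
  · rw [spectrum.mem_resolventSet_iff] at h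
    -- The resolvent set speaks of `μ - K`, while the map wanted is `K - μ`.
    obtain ⟨U, hU⟩ := h.neg
    refine ⟨ContinuousLinearEquiv.ofUnit U, fun v n => ?_⟩
    change (U : lp (fun _ : ℕ => 𝕜) p →L[𝕜] lp (fun _ : ℕ => 𝕜) p) v n = _
    rw [hU, ← hKv]
    simp [Algebra.algebraMap_eq_smul_one]
    rfl

end SequenceOperators

/-! ### Invertibility of the shifted Legendre integration matrix -/

section Invertibility

variable {𝕜 : Type*} [RCLike 𝕜] {p : ℝ≥0∞} [Fact (1 ≤ p)]

/-- Multiplication by `w` identifies `X` isometrically with `ℓ^p` and carries `A` to `T`, so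
bijectivity and both bounds are those of `T`. -/
lemma isInvertibleOn_of_equiv {w : ℕ → ℝ} (hw : ∀ n, 0 < w n) {A : Module.End 𝕜 (ℕ → 𝕜)}
    {X : Set (ℕ → 𝕜)} {N : (ℕ → 𝕜) → ℝ} (hX : ∀ v, v ∈ X ↔ Memℓp (fun n => w n • v n) p)
    (hN : ∀ (u : lp (fun _ : ℕ => 𝕜) p) v, (∀ n, u n = w n • v n) → N v = ‖u‖)
    (T : lp (fun _ : ℕ => 𝕜) p ≃L[𝕜] lp (fun _ : ℕ => 𝕜) p)
    (hT : ∀ (u : lp (fun _ : ℕ => 𝕜) p) v, (∀ n, u n = w n • v n) → ∀ n, T u n = w n • A v n) :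
    IsInvertibleOn X N A := by
  let lift : ∀ v ∈ X, lp (fun _ : ℕ => 𝕜) p := fun v hv => ⟨fun n => w n • v n, (hX v).1 hv⟩
  have hlift : ∀ v (hv : v ∈ X) n, lift v hv n = w n • v n := fun v hv n => rfl
  have hmaps : MapsTo A X X := by
    intro v hv
    rw [hX]
    have h := lp.memℓp (T (lift v hv))
    have e : (T (lift v hv) : ℕ → 𝕜) = fun n => w n • A v n :=
      funext fun n => hT _ _ (hlift v hv) n
    rwa [e] at h
  have hcancel : ∀ {u v : ℕ → 𝕜}, (∀ n, w n • u n = w n • v n) → u = v := fun h =>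
    funext fun n => smul_right_injective 𝕜 (hw n).ne' (h n)
  refine ⟨⟨hmaps, ?_, ?_⟩, ⟨‖(T : lp (fun _ : ℕ => 𝕜) p →L[𝕜] lp (fun _ : ℕ => 𝕜) p)‖,
    fun v hv => ?_⟩,
    ⟨‖(T.symm : lp (fun _ : ℕ => 𝕜) p →L[𝕜] lp (fun _ : ℕ => 𝕜) p)‖, fun v hv => ?_⟩⟩
  · intro u hu v hv huv
    have h : T (lift u hu) = T (lift v hv) := by
      refine lp.ext (funext fun n => ?_)
      rw [hT _ _ (hlift u hu), hT _ _ (hlift v hv), huv]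
    have h' := T.injective h
    refine hcancel fun n => ?_
    rw [← hlift u hu, ← hlift v hv, h']
  · intro y hy
    set u := T.symm (lift y hy) with hu
    set v : ℕ → 𝕜 := fun n => (w n)⁻¹ • u n with hv
    have huv : ∀ n, u n = w n • v n := fun n => (smul_inv_smul₀ (hw n).ne' _).symm
    refine ⟨v, ?_, ?_⟩
    · rw [hX]
      have h := lp.memℓp u
      rwa [show (u : ℕ → 𝕜) = fun n => w n • v n from funext huv] at h
    · refine hcancel fun n => ?_
      rw [← hT u v huv, hu, ContinuousLinearEquiv.apply_symm_apply, hlift y hy]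
  · rw [hN (lift v hv) v (hlift v hv), hN (T (lift v hv)) (A v) (hT _ _ (hlift v hv))]
    exact (T : lp (fun _ : ℕ => 𝕜) p →L[𝕜] lp (fun _ : ℕ => 𝕜) p).le_opNorm _
  · rw [hN (lift v hv) v (hlift v hv), hN (T (lift v hv)) (A v) (hT _ _ (hlift v hv))]
    calc ‖lift v hv‖ = ‖(T.symm : lp (fun _ : ℕ => 𝕜) p →L[𝕜] lp (fun _ : ℕ => 𝕜) p)
          (T (lift v hv))‖ := by simp
      _ ≤ _ := ContinuousLinearMap.le_opNorm _ _

/-- The subdiagonal of the normalized Legendre integration matrix, preceded by its corner entry. -/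
noncomputable def lowerCoef : ℕ → ℝ
  | 0 => 1
  | n + 1 => psi (n + 1) * (psi n)⁻¹ * (1 / (2 * (n : ℝ) + 1))

/-- The superdiagonal of the normalized Legendre integration matrix, up to the sign. -/
noncomputable def upperCoef (n : ℕ) : ℝ := psi n * (psi (n + 1))⁻¹ * (1 / (2 * (n : ℝ) + 3))

/-- For `n = 0` the truncated index `n - 1` is `0`, so `lowerCoef 0` is the corner entry, the only
nonzero one on the diagonal. -/
lemma intPNormalized_eq (v : ℕ → 𝕜) (n : ℕ) :
    intPNormalized v n = lowerCoef n • v (n - 1) - upperCoef n • v (n + 1) := by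
  rw [intPNormalized_apply]
  rcases n with - | n
  · rw [intP_apply_zero, PsiInv_apply, PsiInv_apply, smul_sub, smul_inv_smul₀ (psi_pos 0).ne',
      smul_smul, smul_smul, lowerCoef, upperCoef, one_smul]
    congr 2
    norm_num
    ring
  · rw [intP_apply_succ, PsiInv_apply, PsiInv_apply, smul_sub, smul_smul, smul_smul, smul_smul,
      smul_smul, lowerCoef, upperCoef, Nat.add_sub_cancel]
    congr 2
    · ring
    · push_cast
      rw [show 2 * ((n : ℝ) + 1) + 3 = 2 * n + 5 by ring]
      ring

lemma tendsto_one_div_two_mul_add {c : ℝ} :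
    Filter.Tendsto (fun n : ℕ => 1 / (2 * (n : ℝ) + c)) Filter.atTop (nhds 0) := by
  simp_rw [one_div]
  exact tendsto_inv_atTop_zero.comp (Filter.tendsto_atTop_add_const_right _ _
    (tendsto_natCast_atTop_atTop.const_mul_atTop two_pos))

lemma lowerCoef_nonneg (n : ℕ) : 0 ≤ lowerCoef n := by
  rcases n with - | n
  · exact zero_le_one
  · have := psi_pos n
    have := psi_pos (n + 1)
    unfold lowerCoef
    positivity

lemma upperCoef_nonneg (n : ℕ) : 0 ≤ upperCoef n := by
  have := psi_pos n
  have := psi_pos (n + 1)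
  unfold upperCoef
  positivity

lemma tendsto_lowerCoef : Filter.Tendsto lowerCoef Filter.atTop (nhds 0) := by
  rw [← Filter.tendsto_add_atTop_iff_nat 1]
  refine squeeze_zero (fun n => lowerCoef_nonneg _) (fun n => ?_)
    (tendsto_one_div_two_mul_add (c := 1))
  have h1 := psi_pos n
  have h2 : psi (n + 1) * (psi n)⁻¹ ≤ 1 := by
    rw [← div_eq_mul_inv, div_le_one h1]
    exact psi_anti n.le_succ
  exact mul_le_of_le_one_left (by positivity) h2

lemma tendsto_upperCoef : Filter.Tendsto upperCoef Filter.atTop (nhds 0) := by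
  refine squeeze_zero (fun n => upperCoef_nonneg _) (fun n => ?_)
    (by simpa using (tendsto_one_div_two_mul_add (c := 3)).const_mul 2)
  have h1 := psi_pos (n + 1)
  have h2 : psi n * (psi (n + 1))⁻¹ ≤ 2 := by
    rw [← div_eq_mul_inv, div_le_iff₀ h1]
    exact psi_le_two_mul n
  unfold upperCoef
  simpa using mul_le_mul_of_nonneg_right h2 (by positivity : 0 ≤ 1 / (2 * (n : ℝ) + 3))

lemma tendsto_zero_of_memlp (hp : p ≠ ∞) {v : ℕ → 𝕜} (hv : Memℓp v p) :
    Filter.Tendsto v Filter.atTop (nhds 0) := by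
  have hp0 := toReal_pos_of_ne_top hp
  have h := (hv.summable hp0).tendsto_atTop_zero.rpow_const (p := p.toReal⁻¹)
    (Or.inr (by positivity))
  rw [Real.zero_rpow (by positivity)] at h
  rw [tendsto_zero_iff_norm_tendsto_zero]
  refine h.congr fun n => ?_
  rw [Real.rpow_rpow_inv (norm_nonneg _) hp0.ne']

/-- Conjugation by the weight multiplies the two bands by ratios of neighbouring weights. These are
bounded by `B` below the diagonal and by `1` above it, so the bands still tend to zero and the
Fredholm alternative applies. -/
lemma isInvertibleOn_intPNormalized_sub (hp : p ≠ ∞) {w : ℕ → ℝ} (hw : ∀ n, 0 < w n)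
    (hmono : Monotone w) {B : ℝ} (hB : ∀ n, w n ≤ B * w (n - 1))
    {X : Set (ℕ → 𝕜)} {N : (ℕ → 𝕜) → ℝ} (hX : ∀ v, v ∈ X ↔ Memℓp (fun n => w n • v n) p)
    (hN : ∀ (u : lp (fun _ : ℕ => 𝕜) p) v, (∀ n, u n = w n • v n) → N v = ‖u‖)
    {μ : 𝕜} (hμ : μ ≠ 0) :
    IsInvertibleOn X N (intPNormalized - μ • 1 : Module.End 𝕜 (ℕ → 𝕜)) := by
  set γ : ℕ → ℝ := fun n => w n * (w (n - 1))⁻¹ * lowerCoef n with hγ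
  set δ : ℕ → ℝ := fun n => -(w n * (w (n + 1))⁻¹ * upperCoef n) with hδ
  have hγlim : Filter.Tendsto γ Filter.atTop (nhds 0) := by
    refine squeeze_zero (fun n => ?_) (fun n => ?_) (by simpa using tendsto_lowerCoef.const_mul B)
    · have := hw n
      have := hw (n - 1)
      have := lowerCoef_nonneg n
      positivity
    · refine mul_le_mul_of_nonneg_right ?_ (lowerCoef_nonneg n)
      rw [← div_eq_mul_inv, div_le_iff₀ (hw _)]
      exact hB n
  have hδlim : Filter.Tendsto δ Filter.atTop (nhds 0) := by
    rw [← neg_zero]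
    refine (squeeze_zero (fun n => ?_) (fun n => ?_) tendsto_upperCoef).neg
    · have := hw n
      have := hw (n + 1)
      have := upperCoef_nonneg n
      positivity
    · refine mul_le_of_le_one_left (upperCoef_nonneg n) ?_
      rw [← div_eq_mul_inv, div_le_one (hw _)]
      exact hmono n.le_succ
  have key : ∀ u v : ℕ → 𝕜, (∀ n, u n = w n • v n) → ∀ n,
      γ n • u (n - 1) + δ n • u (n + 1) = w n • intPNormalized v n := by
    intro u v huv n
    rw [intPNormalized_eq, huv, huv, smul_sub, smul_smul, smul_smul, smul_smul, smul_smul,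
      sub_eq_add_neg, ← neg_smul]
    have h1 := (hw (n - 1)).ne'
    have h2 := (hw (n + 1)).ne'
    congr 2
    · simp only [hγ]
      field_simp
    · simp only [hδ]
      field_simp
  have hinj : ∀ u : ℕ → 𝕜, Memℓp u p →
      (∀ n, γ n • u (n - 1) + δ n • u (n + 1) = μ * u n) → u = 0 := by
    intro u hu h
    set v : ℕ → 𝕜 := fun n => (w n)⁻¹ • u n with hv
    have huv : ∀ n, u n = w n • v n := fun n => (smul_inv_smul₀ (hw n).ne' _).symm
    -- The weight is at least `w 0`, so removing it keeps the sequence null.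
    have hvlim : Filter.Tendsto v Filter.atTop (nhds 0) := by
      refine squeeze_zero_norm (fun n => ?_)
        (by simpa using (tendsto_zero_of_memlp hp hu).norm.const_mul (w 0)⁻¹)
      rw [hv, norm_smul, norm_inv, Real.norm_of_nonneg (hw n).le]
      have := hw 0
      have := hmono (Nat.zero_le n)
      gcongr
    have hz : v = 0 := by
      refine eq_zero_of_intPNormalized_eq hμ hvlim (funext fun n => ?_)
      refine smul_right_injective 𝕜 (hw n).ne' ?_
      simp only
      rw [← key u v huv, h, huv, Pi.smul_apply, smul_eq_mul, mul_smul_comm]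
    funext n
    rw [huv, hz]
    simp
  obtain ⟨T, hT⟩ := exists_equiv_of_tridiagonal hp hγlim hδlim hμ hinj
  refine isInvertibleOn_of_equiv hw hX hN T fun u v huv n => ?_
  rw [hT, key u v huv, huv, LinearMap.sub_apply, Pi.sub_apply, smul_sub, LinearMap.smul_apply,
    Module.End.one_apply, Pi.smul_apply, smul_eq_mul, mul_smul_comm]

lemma isInvertibleOn_ellOne {μ : 𝕜} (hμ : μ ≠ 0) :
    IsInvertibleOn ellOne ellOneNorm (intPNormalized - μ • 1 : Module.End 𝕜 (ℕ → 𝕜)) := by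
  refine isInvertibleOn_intPNormalized_sub (p := 1) (w := fun _ => 1) (B := 1) ENNReal.one_ne_top
    (fun _ => zero_lt_one) monotone_const (fun _ => by simp) (fun v => ?_) (fun u v huv => ?_) hμ
  · rw [memℓp_gen_iff (by simp)]
    simp [ellOne]
  · rw [lp.norm_eq_tsum_rpow (by simp)]
    simp [ellOneNorm, huv]

lemma weight_sq {lam x : ℝ} (hx : 0 < x) (y : 𝕜) :
    ‖x ^ lam • y‖ ^ 2 = x ^ (2 * lam) * ‖y‖ ^ 2 := by
  rw [norm_smul, mul_pow, Real.norm_of_nonneg (by positivity), ← Real.rpow_natCast (x ^ lam),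
    ← Real.rpow_mul hx.le, mul_comm lam]
  norm_num

lemma isInvertibleOn_ellTwo {μ : 𝕜} (hμ : μ ≠ 0) {lam : ℝ} (hlam : 0 ≤ lam) :
    IsInvertibleOn (ellTwo lam) (ellTwoNorm lam)
      (intPNormalized - μ • 1 : Module.End 𝕜 (ℕ → 𝕜)) := by
  have hpos : ∀ n : ℕ, (0 : ℝ) < (n : ℝ) + 1 := fun n => by positivity
  refine isInvertibleOn_intPNormalized_sub (p := 2) (w := fun n => ((n : ℝ) + 1) ^ lam)
    (B := 2 ^ lam) ENNReal.ofNat_ne_top (fun n => by positivity) (fun m n hmn => ?_) (fun n => ?_)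
    (fun v => ?_) (fun u v huv => ?_) hμ
  · have : (m : ℝ) ≤ n := by exact_mod_cast hmn
    simp only
    gcongr
  · rw [← Real.mul_rpow zero_le_two (hpos _).le]
    -- The truncated subtraction at `n = 0` is harmless, and the ratio `2` is attained at `n = 1`.
    have : n + 1 ≤ 2 * ((n - 1) + 1) := by omega
    have : (n : ℝ) + 1 ≤ 2 * (((n - 1 : ℕ) : ℝ) + 1) := by exact_mod_cast this
    gcongr
  · rw [memℓp_gen_iff (by simp)]
    simp [ellTwo, weight_sq (hpos _)]
  · rw [lp.norm_eq_tsum_rpow (by simp), ellTwoNorm, Real.sqrt_eq_rpow]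
    simp [huv, weight_sq (hpos _)]

end Invertibility

/-! ### Half-integrals of Legendre and weighted Chebyshev polynomials -/

lemma intervalIntegrable_inv_sqrt {a x : ℝ} (hx : a ≤ x) :
    IntervalIntegrable (fun t => (√(x - t))⁻¹) volume a x := by
  have h : IntervalIntegrable (fun s : ℝ => s ^ (-(1 / 2) : ℝ)) volume (x - a) (x - x) :=
    intervalIntegral.intervalIntegrable_rpow' (by norm_num)
  have h2 := h.comp_sub_left x
  simp only [sub_sub_cancel] at h2
  refine h2.congr fun t ht => ?_
  rw [uIoc_of_le hx] at ht
  have : 0 ≤ x - t := by linarith [ht.2]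
  rw [Real.rpow_neg this, Real.sqrt_eq_rpow]

lemma intervalIntegrable_inv_sqrt_smul {x : ℝ} (hx : -1 ≤ x) {φ : ℝ → ℝ} (hφ : Continuous φ) :
    IntervalIntegrable (fun t => (√(x - t))⁻¹ • φ t) volume (-1) x :=
  (intervalIntegrable_inv_sqrt hx).mul_continuousOn hφ.continuousOn

lemma halfInt_add {x : ℝ} (hx : -1 ≤ x) {φ χ : ℝ → ℝ} (hφ : Continuous φ) (hχ : Continuous χ) :
    halfInt (fun t => φ t + χ t) x = halfInt φ x + halfInt χ x := by
  unfold halfInt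
  rw [← smul_add, ← intervalIntegral.integral_add (intervalIntegrable_inv_sqrt_smul hx hφ)
    (intervalIntegrable_inv_sqrt_smul hx hχ)]
  simp only [smul_add]

lemma halfInt_const_mul (c x : ℝ) (φ : ℝ → ℝ) :
    halfInt (fun t => c * φ t) x = c * halfInt φ x := by
  unfold halfInt
  simp only [smul_eq_mul, mul_left_comm _ c, intervalIntegral.integral_const_mul]

lemma integral_inv_sqrt {a x : ℝ} (hx : a ≤ x) : ∫ t in a..x, (√(x - t))⁻¹ = 2 * √(x - a) := by
  have h : ∫ t in a..x, (√(x - t))⁻¹ = -2 * √(x - x) - -2 * √(x - a) := by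
    refine intervalIntegral.integral_eq_sub_of_hasDerivAt_of_le hx (by fun_prop)
      (f := fun t => -2 * √(x - t)) (fun t ht => ?_) (intervalIntegrable_inv_sqrt hx)
    have hne : x - t ≠ 0 := by linarith [ht.2]
    convert! (((hasDerivAt_id t).const_sub x).sqrt hne).const_mul (-2) using 1
    simp only [id]
    have : √(x - t) ≠ 0 := (Real.sqrt_pos.2 (by linarith [ht.2])).ne'
    field_simp
  rw [h, sub_self, Real.sqrt_zero]
  ring

lemma halfInt_one {x : ℝ} (hx : -1 ≤ x) :
    halfInt (fun _ => (1 : ℝ)) x = 2 / √Real.pi * √(1 + x) := by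
  unfold halfInt
  simp only [smul_eq_mul, mul_one, integral_inv_sqrt hx]
  rw [sub_neg_eq_add, add_comm x 1]
  ring

/-- Multiplication by the variable commutes with the half-integral up to half of the half-integral
of the antiderivative. -/
lemma halfInt_id_mul {x : ℝ} (hx : -1 ≤ x) {φ W : ℝ → ℝ} (hφ : Continuous φ) (hW : Continuous W)
    (hd : ∀ t, -1 < t → HasDerivAt W (φ t) t) (h0 : W (-1) = 0) :
    halfInt (fun t => t * φ t) x = x * halfInt φ x - 1 / 2 * halfInt W x := by
  have i1 := intervalIntegrable_inv_sqrt_smul hx hφ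
  have i2 := intervalIntegrable_inv_sqrt_smul hx hW
  have i3 : IntervalIntegrable (fun t => (√(x - t))⁻¹ • (t * φ t)) volume (-1) x :=
    intervalIntegrable_inv_sqrt_smul hx (continuous_id.mul hφ)
  -- The integrand is the derivative of `√(x - t) W t`, using `(x - t)/√(x - t) = √(x - t)`. The
  -- boundary terms vanish, at `x` by the square root and at `-1` by `W (-1) = 0`.
  have h : ∫ t in (-1 : ℝ)..x, (-(1 / 2) * ((√(x - t))⁻¹ • W t)
      + (x * ((√(x - t))⁻¹ • φ t) - (√(x - t))⁻¹ • (t * φ t)))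
      = √(x - x) * W x - √(x - -1) * W (-1) := by
    refine intervalIntegral.integral_eq_sub_of_hasDerivAt_of_le hx
      (f := fun t => √(x - t) * W t) (by fun_prop) (fun t ht => ?_)
      ((i2.const_mul _).add ((i1.const_mul _).sub i3))
    have hpos : 0 < x - t := by linarith [ht.2]
    convert! (((hasDerivAt_id t).const_sub x).sqrt hpos.ne').mul (hd t ht.1) using 1
    simp only [id, smul_eq_mul]
    have h1 : √(x - t) ≠ 0 := (Real.sqrt_pos.2 hpos).ne'
    have h2 : √(x - t) ^ 2 = x - t := Real.sq_sqrt hpos.le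
    field_simp
    linear_combination (-2 * φ t) * h2
  rw [intervalIntegral.integral_add (i2.const_mul _) ((i1.const_mul _).sub i3),
    intervalIntegral.integral_sub (i1.const_mul _) i3, intervalIntegral.integral_const_mul,
    intervalIntegral.integral_const_mul, h0, sub_self, Real.sqrt_zero] at h
  unfold halfInt
  simp only [smul_eq_mul] at h ⊢
  linear_combination -(√Real.pi)⁻¹ * h

/-! ### Derivative identities for `Uₙ ± Uₙ₋₁` -/

/-- The difference `Uₙ - Uₙ₋₁` of Chebyshev polynomials of the second kind. -/
noncomputable def chebDiff (n : ℕ) : Polynomial ℝ :=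
  Polynomial.Chebyshev.U ℝ (n : ℤ) - Polynomial.Chebyshev.U ℝ ((n : ℤ) - 1)

/-- The sum `Uₙ + Uₙ₋₁` of Chebyshev polynomials of the second kind. -/
noncomputable def chebSum (n : ℕ) : Polynomial ℝ :=
  Polynomial.Chebyshev.U ℝ (n : ℤ) + Polynomial.Chebyshev.U ℝ ((n : ℤ) - 1)

lemma eval_chebDiff_zero (x : ℝ) : (chebDiff 0).eval x = chebU 0 x := by simp [chebDiff, chebU]

lemma eval_chebDiff_succ (n : ℕ) (x : ℝ) :
    (chebDiff (n + 1)).eval x = chebU (n + 1) x - chebU n x := by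
  simp [chebDiff, chebU]

open Polynomial in
lemma chebU_poly_succ (n : ℕ) : Chebyshev.U ℝ ((n : ℤ) + 1)
    = 2 * X * Chebyshev.U ℝ (n : ℤ) - Chebyshev.U ℝ ((n : ℤ) - 1) := by
  have := Chebyshev.U_add_two ℝ ((n : ℤ) - 1)
  rwa [show (n : ℤ) - 1 + 2 = n + 1 by ring, show (n : ℤ) - 1 + 1 = n by ring] at this

open Polynomial in
lemma chebDiff_succ (n : ℕ) : chebDiff (n + 1) = X * chebDiff n - (1 - X) * chebSum n := by
  simp only [chebDiff, chebSum]
  push_cast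
  rw [chebU_poly_succ, add_sub_cancel_right]
  ring

open Polynomial in
lemma chebSum_succ (n : ℕ) : chebSum (n + 1) = X * chebSum n + (1 + X) * chebDiff n := by
  simp only [chebDiff, chebSum]
  push_cast
  rw [chebU_poly_succ, add_sub_cancel_right]
  ring

open Polynomial in
-- With `x = cos θ` the difference is `cos((n+½)θ)/cos(θ/2)` and the sum is `sin((n+½)θ)/sin(θ/2)`;
-- the identities differentiate the numerators. Each mixes both families, hence the joint induction.
lemma chebDiff_derivative (n : ℕ) :
    chebDiff n + 2 * (1 + X) * derivative (chebDiff n) = (2 * (n : ℝ[X]) + 1) * chebSum n ∧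
    chebSum n - 2 * (1 - X) * derivative (chebSum n) = (2 * (n : ℝ[X]) + 1) * chebDiff n := by
  induction n with
  | zero => simp [chebDiff, chebSum]
  | succ n ih =>
    obtain ⟨h1, h2⟩ := ih
    rw [chebDiff_succ, chebSum_succ]
    simp only [derivative_sub, derivative_add, derivative_mul, derivative_X, derivative_one]
    push_cast
    constructor
    · linear_combination X * h1 + (1 + X) * h2
    · linear_combination X * h2 - (1 - X) * h1

/-- The antiderivative of `√(1+x) Uₙ(x)` that vanishes at `-1`. -/
lemma hasDerivAt_sqrt_mul_chebDiff (n : ℕ) {t : ℝ} (ht : -1 < t) :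
    HasDerivAt (fun t => √(1 + t) * ((2 * (n : ℝ) + 3)⁻¹ * (chebDiff (n + 1)).eval t
      + (2 * (n : ℝ) + 1)⁻¹ * (chebDiff n).eval t)) (√(1 + t) * chebU n t) t := by
  have hpos : 0 < 1 + t := by linarith
  have h := (((hasDerivAt_id t).const_add 1).sqrt hpos.ne').mul
    ((((chebDiff (n + 1)).hasDerivAt t).const_mul (2 * (n : ℝ) + 3)⁻¹).add
      (((chebDiff n).hasDerivAt t).const_mul (2 * (n : ℝ) + 1)⁻¹))
  convert! h using 1
  have e1 := congrArg (Polynomial.eval t) (chebDiff_derivative n).1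
  have e2 := congrArg (Polynomial.eval t) (chebDiff_derivative (n + 1)).1
  -- The coefficients `(2n+3)⁻¹` and `(2n+1)⁻¹` cancel the factors in the derivative identities,
  -- leaving exactly this sum.
  have e3 : (chebSum (n + 1)).eval t + (chebSum n).eval t = 2 * (1 + t) * chebU n t := by
    have := congrArg (Polynomial.eval t) (chebU_poly_succ n)
    simp only [chebSum, chebU] at this ⊢
    push_cast
    rw [add_sub_cancel_right]
    simp only [Polynomial.eval_add, Polynomial.eval_sub, Polynomial.eval_mul,
      Polynomial.eval_ofNat, Polynomial.eval_X] at this ⊢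
    linear_combination this
  simp only [Polynomial.eval_add, Polynomial.eval_mul, Polynomial.eval_ofNat, Polynomial.eval_X,
    Polynomial.eval_one, Polynomial.eval_natCast] at e1 e2
  push_cast at e2
  have hs : √(1 + t) ≠ 0 := (Real.sqrt_pos.2 hpos).ne'
  have hs2 : √(1 + t) ^ 2 = 1 + t := Real.sq_sqrt hpos.le
  have hn1 : 2 * (n : ℝ) + 1 ≠ 0 := by positivity
  have hn3 : 2 * (n : ℝ) + 3 ≠ 0 := by positivity
  have e4 : (2 * (n : ℝ) + 3)⁻¹ * ((chebDiff (n + 1)).eval t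
      + 2 * (1 + t) * (chebDiff (n + 1)).derivative.eval t) + (2 * (n : ℝ) + 1)⁻¹ *
      ((chebDiff n).eval t + 2 * (1 + t) * (chebDiff n).derivative.eval t)
      = 2 * (1 + t) * chebU n t := by
    rw [← e3, e1, e2]
    field_simp
    ring
  apply mul_left_cancel₀ (mul_ne_zero two_ne_zero hs)
  have e5 : 1 / (2 * √(1 + t)) * (2 * √(1 + t)) = 1 := by field_simp
  simp only [id, Pi.add_apply]
  generalize (chebDiff (n + 1)).eval t = a at *
  generalize (chebDiff n).eval t = b at *
  generalize (chebDiff (n + 1)).derivative.eval t = a' at *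
  generalize (chebDiff n).derivative.eval t = b' at *
  linear_combination -e4 + (2 * chebU n t - 2 * ((2 * (n : ℝ) + 3)⁻¹ * a'
    + (2 * (n : ℝ) + 1)⁻¹ * b')) * hs2 - ((2 * (n : ℝ) + 3)⁻¹ * a + (2 * (n : ℝ) + 1)⁻¹ * b) * e5

/-- The weighted Chebyshev polynomial `√(1+x) Uₙ(x)`. -/
noncomputable def sqrtChebU (n : ℕ) (x : ℝ) : ℝ := √(1 + x) * chebU n x

lemma continuous_sqrtChebU (n : ℕ) : Continuous (sqrtChebU n) := by
  have := continuous_chebU n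
  unfold sqrtChebU
  fun_prop

/-! ### Recurrences and closed forms for the half-integrals -/

lemma halfInt_legendreP_zero {x : ℝ} (hx : -1 ≤ x) :
    halfInt (legendreP 0) x = 2 / √Real.pi * √(1 + x) := by
  rw [← halfInt_one hx]
  congr 1

lemma halfInt_legendreP_one {x : ℝ} (hx : -1 ≤ x) :
    3 * halfInt (legendreP 1) x = (2 * x - 1) * halfInt (legendreP 0) x := by
  have h := halfInt_id_mul hx (continuous_legendreP 0)
    ((continuous_legendreP 0).add (continuous_legendreP 1))
    (fun t _ => by
      convert! (hasDerivAt_legendreP 0 t).add (hasDerivAt_legendreP 1 t) using 1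
      simp [legendreP'_zero, legendreP'_one, legendreP])
    (by simp [legendreP])
  have e : halfInt (legendreP 0 + legendreP 1) x
      = halfInt (legendreP 0) x + halfInt (legendreP 1) x :=
    halfInt_add hx (continuous_legendreP 0) (continuous_legendreP 1)
  have e2 : (fun t => t * legendreP 0 t) = legendreP 1 := by
    funext t
    simp [legendreP]
  rw [e, e2] at h
  linear_combination 2 * h

/-- The antiderivative `(Pₙ₊₂ - Pₙ)/(2n+3)` of `Pₙ₊₁` vanishes at `-1` by parity. Inserting it in
`halfInt_id_mul` turns the Legendre recurrence into one for the half-integrals. -/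
lemma halfInt_legendreP_add_two {x : ℝ} (hx : -1 ≤ x) (n : ℕ) :
    (2 * (n : ℝ) + 5) * halfInt (legendreP (n + 2)) x
      = 2 * (2 * (n : ℝ) + 3) * x * halfInt (legendreP (n + 1)) x
        - (2 * (n : ℝ) + 1) * halfInt (legendreP n) x := by
  have c0 := continuous_legendreP n
  have c1 := continuous_legendreP (n + 1)
  have c2 := continuous_legendreP (n + 2)
  have hn : 2 * (n : ℝ) + 3 ≠ 0 := by positivity
  have h := halfInt_id_mul hx c1
    (W := fun t => (2 * (n : ℝ) + 3)⁻¹ * legendreP (n + 2) t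
      + -(2 * (n : ℝ) + 3)⁻¹ * legendreP n t) (by fun_prop)
    (fun t _ => by
      convert! ((hasDerivAt_legendreP (n + 2) t).const_mul (2 * (n : ℝ) + 3)⁻¹).add
        ((hasDerivAt_legendreP n t).const_mul (-(2 * (n : ℝ) + 3)⁻¹)) using 1
      have := legendreP'_sub n t
      rw [sub_eq_iff_eq_add] at this
      rw [this]
      field_simp
      ring)
    (by
      rw [legendreP_at_neg_one, legendreP_at_neg_one]
      ring)
  rw [halfInt_add hx (by fun_prop) (by fun_prop), halfInt_const_mul, halfInt_const_mul] at h
  have e : halfInt (legendreP (n + 2)) x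
      = ((n : ℝ) + 2)⁻¹ * (2 * (n : ℝ) + 3) * halfInt (fun t => t * legendreP (n + 1) t) x
        + -(((n : ℝ) + 2)⁻¹ * ((n : ℝ) + 1)) * halfInt (legendreP n) x := by
    rw [← halfInt_const_mul, ← halfInt_const_mul, ← halfInt_add hx (by fun_prop) (by fun_prop)]
    congr 1
    funext t
    rw [legendreP]
    field_simp
    ring
  rw [h] at e
  have hn2 : (n : ℝ) + 2 ≠ 0 := by positivity
  field_simp at e
  linear_combination e

/-- The half-integral of a Legendre polynomial. -/
lemma halfInt_legendreP {x : ℝ} (hx : -1 ≤ x) : ∀ n : ℕ,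
    (2 * (n : ℝ) + 1) * halfInt (legendreP n) x
      = 2 / √Real.pi * √(1 + x) * (chebDiff n).eval x
  | 0 => by
    rw [halfInt_legendreP_zero hx, eval_chebDiff_zero, chebU_zero]
    push_cast
    ring
  | 1 => by
    have h := halfInt_legendreP_one hx
    rw [halfInt_legendreP_zero hx] at h
    rw [eval_chebDiff_succ, chebU_zero, chebU_one]
    push_cast
    linear_combination h
  | n + 2 => by
    have h := halfInt_legendreP_add_two hx n
    have h0 := halfInt_legendreP hx n
    have h1 := halfInt_legendreP hx (n + 1)
    have hD : (chebDiff (n + 2)).eval x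
        = 2 * x * (chebDiff (n + 1)).eval x - (chebDiff n).eval x := by
      rcases n with - | n
      · rw [eval_chebDiff_succ, eval_chebDiff_succ, eval_chebDiff_zero, chebU_add_two, chebU_zero,
          chebU_one]
        ring
      · rw [eval_chebDiff_succ, eval_chebDiff_succ, eval_chebDiff_succ, chebU_add_two,
          chebU_add_two n]
        ring
    rw [hD]
    push_cast at h1 ⊢
    linear_combination h + 2 * x * h1 - h0

/-- The integrand `√((1+t)/(x-t))` has an explicit primitive whose arcsine runs from `-π/2` to
`π/2`, contributing `π(1+x)/2`. -/
lemma halfInt_sqrtChebU_zero {x : ℝ} (hx : -1 < x) :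
    halfInt (sqrtChebU 0) x = √Real.pi / 2 * (1 + x) := by
  have hx1 : 0 < 1 + x := by linarith
  have h : ∫ t in (-1 : ℝ)..x, (√(x - t))⁻¹ • sqrtChebU 0 t
      = (-√((1 + x) * (x - x)) + (1 + x) / 2 * Real.arcsin ((2 * x + 1 - x) / (1 + x)))
        - (-√((1 + -1) * (x - -1)) + (1 + x) / 2 * Real.arcsin ((2 * -1 + 1 - x) / (1 + x))) := by
    refine intervalIntegral.integral_eq_sub_of_hasDerivAt_of_le hx.le
      (f := fun t => -√((1 + t) * (x - t)) + (1 + x) / 2 * Real.arcsin ((2 * t + 1 - x) / (1 + x)))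
      (by fun_prop) (fun t ht => ?_)
      (intervalIntegrable_inv_sqrt_smul hx.le (continuous_sqrtChebU 0))
    have p1 : 0 < 1 + t := by linarith [ht.1]
    have p2 : 0 < x - t := by linarith [ht.2]
    have hlt1 : (2 * t + 1 - x) / (1 + x) ≠ -1 := by
      rw [Ne, div_eq_iff hx1.ne']
      intro h
      linarith
    have hlt2 : (2 * t + 1 - x) / (1 + x) ≠ 1 := by
      rw [Ne, div_eq_iff hx1.ne']
      intro h
      linarith
    have d1 : HasDerivAt (fun t => (1 + t) * (x - t)) (1 * (x - t) + (1 + t) * -1) t :=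
      ((hasDerivAt_id t).const_add 1).mul ((hasDerivAt_id t).const_sub x)
    have d2 : HasDerivAt (fun t => (2 * t + 1 - x) / (1 + x)) (2 / (1 + x)) t := by
      simpa using (((((hasDerivAt_id t).const_mul 2).add_const 1).sub_const x).div_const (1 + x))
    have d3 := (d1.sqrt (mul_pos p1 p2).ne').neg.add
      (((Real.hasDerivAt_arcsin hlt1 hlt2).comp t d2).const_mul ((1 + x) / 2))
    convert! d3 using 1
    have s1 : 0 < √(1 + t) := Real.sqrt_pos.2 p1
    have s2 : 0 < √(x - t) := Real.sqrt_pos.2 p2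
    have e : √(1 - ((2 * t + 1 - x) / (1 + x)) ^ 2)
        = 2 * (√(1 + t) * √(x - t)) / (1 + x) := by
      rw [← Real.sqrt_mul p1.le, Real.sqrt_eq_iff_mul_self_eq_of_pos]
      · have := Real.mul_self_sqrt (mul_pos p1 p2).le
        field_simp
        linear_combination 4 * this
      · have := Real.sqrt_pos.2 (mul_pos p1 p2)
        positivity
    have q1 : √(1 + t) ^ 2 = 1 + t := Real.sq_sqrt p1.le
    rw [e, Real.sqrt_mul p1.le, sqrtChebU, chebU_zero]
    simp only [smul_eq_mul]
    field_simp
    linear_combination 2 * q1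
  rw [halfInt, h, sub_self, mul_zero, add_neg_cancel, zero_mul, Real.sqrt_zero,
    show (2 * x + 1 - x) / (1 + x) = 1 by field_simp; ring,
    show (2 * -1 + 1 - x) / (1 + x) = -1 by field_simp; ring, Real.arcsin_one,
    Real.arcsin_neg_one, smul_eq_mul]
  have hpi : (√Real.pi) ≠ 0 := (Real.sqrt_pos.2 Real.pi_pos).ne'
  have hpi2 : √Real.pi ^ 2 = Real.pi := Real.sq_sqrt Real.pi_pos.le
  field_simp
  linear_combination (-2 * (1 + x)) * hpi2

lemma halfInt_id_mul_sqrtChebU {x : ℝ} (hx : -1 ≤ x) (n : ℕ) :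
    halfInt (fun t => t * sqrtChebU n t) x = x * halfInt (sqrtChebU n) x
      - 1 / 2 * halfInt (fun t => √(1 + t) * ((2 * (n : ℝ) + 3)⁻¹ * (chebDiff (n + 1)).eval t
      + (2 * (n : ℝ) + 1)⁻¹ * (chebDiff n).eval t)) x :=
  halfInt_id_mul hx (continuous_sqrtChebU n) (by fun_prop)
    (fun _ ht => hasDerivAt_sqrt_mul_chebDiff n ht) (by simp)

lemma halfInt_sqrtChebU_one {x : ℝ} (hx : -1 ≤ x) :
    2 * halfInt (sqrtChebU 1) x = (3 * x - 1) * halfInt (sqrtChebU 0) x := by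
  have c0 := continuous_sqrtChebU 0
  have c1 := continuous_sqrtChebU 1
  have h := halfInt_id_mul_sqrtChebU hx 0
  have e1 : halfInt (fun t => √(1 + t) * ((2 * ((0 : ℕ) : ℝ) + 3)⁻¹ * (chebDiff (0 + 1)).eval t
      + (2 * ((0 : ℕ) : ℝ) + 1)⁻¹ * (chebDiff 0).eval t)) x
      = 1 / 3 * halfInt (sqrtChebU 1) x + 2 / 3 * halfInt (sqrtChebU 0) x := by
    rw [← halfInt_const_mul, ← halfInt_const_mul, ← halfInt_add hx (by fun_prop) (by fun_prop)]
    congr 1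
    funext t
    rw [eval_chebDiff_succ, eval_chebDiff_zero, sqrtChebU, sqrtChebU]
    push_cast
    ring
  have e2 : halfInt (fun t => t * sqrtChebU 0 t) x = 1 / 2 * halfInt (sqrtChebU 1) x := by
    rw [← halfInt_const_mul]
    congr 1
    funext t
    rw [sqrtChebU, sqrtChebU, chebU_zero, chebU_one]
    ring
  rw [e1, e2] at h
  linear_combination 3 * h

/-- Both sides of `halfInt_id_mul_sqrtChebU` at `n + 1` are expanded in weighted Chebyshev
polynomials, the left one by the recurrence of `Uₙ`. -/
lemma halfInt_sqrtChebU_add_two {x : ℝ} (hx : -1 ≤ x) (n : ℕ) :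
    (2 * (n : ℝ) + 3) * (2 * (n : ℝ) + 6) * halfInt (sqrtChebU (n + 2)) x
      = (2 * x * (2 * (n : ℝ) + 3) * (2 * (n : ℝ) + 5) - 2) * halfInt (sqrtChebU (n + 1)) x
        - (2 * (n : ℝ) + 2) * (2 * (n : ℝ) + 5) * halfInt (sqrtChebU n) x := by
  have c0 := continuous_sqrtChebU n
  have c1 := continuous_sqrtChebU (n + 1)
  have c2 := continuous_sqrtChebU (n + 2)
  have h := halfInt_id_mul_sqrtChebU hx (n + 1)
  have hn3 : 2 * (n : ℝ) + 3 ≠ 0 := by positivity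
  have hn5 : 2 * (n : ℝ) + 5 ≠ 0 := by positivity
  have e1 : halfInt (fun t => √(1 + t) * ((2 * ((n + 1 : ℕ) : ℝ) + 3)⁻¹ *
      (chebDiff (n + 1 + 1)).eval t + (2 * ((n + 1 : ℕ) : ℝ) + 1)⁻¹ * (chebDiff (n + 1)).eval t)) x
      = (2 * (n : ℝ) + 5)⁻¹ * halfInt (sqrtChebU (n + 2)) x
        + ((2 * (n : ℝ) + 3)⁻¹ - (2 * (n : ℝ) + 5)⁻¹) * halfInt (sqrtChebU (n + 1)) x
        + -(2 * (n : ℝ) + 3)⁻¹ * halfInt (sqrtChebU n) x := by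
    rw [← halfInt_const_mul, ← halfInt_const_mul, ← halfInt_const_mul,
      ← halfInt_add hx (by fun_prop) (by fun_prop), ← halfInt_add hx (by fun_prop) (by fun_prop)]
    congr 1
    funext t
    rw [eval_chebDiff_succ, eval_chebDiff_succ, sqrtChebU, sqrtChebU, sqrtChebU]
    push_cast
    rw [show 2 * ((n : ℝ) + 1) + 3 = 2 * n + 5 by ring,
      show 2 * ((n : ℝ) + 1) + 1 = 2 * n + 3 by ring]
    ring
  have e2 : halfInt (fun t => t * sqrtChebU (n + 1) t) x
      = 1 / 2 * halfInt (sqrtChebU (n + 2)) x + 1 / 2 * halfInt (sqrtChebU n) x := by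
    rw [← halfInt_const_mul, ← halfInt_const_mul, ← halfInt_add hx (by fun_prop) (by fun_prop)]
    congr 1
    funext t
    rw [sqrtChebU, sqrtChebU, sqrtChebU, chebU_add_two]
    ring
  rw [e1, e2] at h
  field_simp at h
  linear_combination h

/-- The half-integral of a weighted Chebyshev polynomial. -/
lemma halfInt_sqrtChebU {x : ℝ} (hx : -1 < x) : ∀ n : ℕ,
    halfInt (sqrtChebU n) x = √Real.pi / 2 * (legendreP n x + legendreP (n + 1) x)
  | 0 => by
    rw [halfInt_sqrtChebU_zero hx]
    simp [legendreP]
  | 1 => by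
    have h := halfInt_sqrtChebU_one hx.le
    rw [halfInt_sqrtChebU_zero hx] at h
    have h2 := legendreP_recurrence 0 x
    simp only [legendreP] at h2 ⊢
    push_cast at h2 ⊢
    linear_combination h / 2
  | n + 2 => by
    -- The sums `Pₙ + Pₙ₊₁` satisfy this recurrence too, as a combination of the Legendre
    -- recurrences at `n` and `n + 1`.
    have h := halfInt_sqrtChebU_add_two hx.le n
    rw [halfInt_sqrtChebU hx n, halfInt_sqrtChebU hx (n + 1)] at h
    have r1 := legendreP_recurrence n x
    have r2 := legendreP_recurrence (n + 1) x
    push_cast at r2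
    have hn : (2 * (n : ℝ) + 3) * (2 * (n : ℝ) + 6) ≠ 0 := by positivity
    apply mul_left_cancel₀ hn
    rw [h]
    linear_combination √Real.pi / 2 * (-2 * (2 * (n : ℝ) + 3) * r2 - 2 * (2 * (n : ℝ) + 5) * r1)

/-! ### Expansions with absolutely summable coefficients -/

section Series

variable {𝕜 : Type*} [RCLike 𝕜]

lemma ellOne_add {u v : ℕ → 𝕜} (hu : u ∈ ellOne) (hv : v ∈ ellOne) : u + v ∈ ellOne :=
  Summable.of_nonneg_of_le (fun _ => norm_nonneg _) (fun _ => norm_add_le _ _) (hu.add hv)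

lemma ellOne_smul (c : 𝕜) {u : ℕ → 𝕜} (hu : u ∈ ellOne) : c • u ∈ ellOne := by
  change Summable fun k => ‖c • u k‖
  simpa only [norm_smul] using hu.mul_left ‖c‖

lemma ellOne_sub {u v : ℕ → 𝕜} (hu : u ∈ ellOne) (hv : v ∈ ellOne) : u - v ∈ ellOne :=
  Summable.of_nonneg_of_le (fun _ => norm_nonneg _) (fun _ => norm_sub_le _ _) (hu.add hv)

lemma ellOne_of_norm_le {u v : ℕ → 𝕜} (hu : u ∈ ellOne) {C : ℝ} (h : ∀ n, ‖v n‖ ≤ C * ‖u n‖) :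
    v ∈ ellOne :=
  Summable.of_nonneg_of_le (fun _ => norm_nonneg _) h (hu.mul_left C)

lemma ellOne_shift {u : ℕ → 𝕜} (hu : u ∈ ellOne) : (fun n => u (n + 1)) ∈ ellOne :=
  (summable_nat_add_iff (f := fun n => ‖u n‖) 1).2 hu

lemma ellOne_unshift {u : ℕ → 𝕜} (hu : (fun n => u (n + 1)) ∈ ellOne) : u ∈ ellOne :=
  (summable_nat_add_iff (f := fun n => ‖u n‖) 1).1 hu

lemma norm_inv_odd_smul_le (n : ℕ) (z : 𝕜) :
    ‖(1 / (2 * (n : ℝ) + 1)) • z‖ ≤ 1 * ‖z‖ := by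
  rw [norm_smul, Real.norm_of_nonneg (by positivity)]
  gcongr
  rw [div_le_one (by positivity)]
  linarith [(Nat.cast_nonneg n : (0 : ℝ) ≤ n)]

lemma halfP_apply (a : ℕ → 𝕜) (n : ℕ) : halfP a n = (2 / √Real.pi) •
    ((1 / (2 * (n : ℝ) + 1)) • a n - (1 / (2 * ((n + 1 : ℕ) : ℝ) + 1)) • a (n + 1)) := by
  simp only [halfP, LinearMap.coe_mk, AddHom.coe_mk]
  push_cast
  rw [show 2 * ((n : ℝ) + 1) + 1 = 2 * n + 3 by ring]

lemma halfU_apply_zero (b : ℕ → 𝕜) : halfU b 0 = (√Real.pi / 2) • b 0 := by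
  simp [halfU]

lemma halfU_apply_succ (b : ℕ → 𝕜) (n : ℕ) :
    halfU b (n + 1) = (√Real.pi / 2) • (b (n + 1) + b n) := by
  simp [halfU]

lemma halfP_mem_ellOne {a : ℕ → 𝕜} (ha : a ∈ ellOne) : halfP a ∈ ellOne := by
  have h1 : (fun n : ℕ => (1 / (2 * (n : ℝ) + 1)) • a n) ∈ ellOne :=
    ellOne_of_norm_le ha fun n => norm_inv_odd_smul_le n (a n)
  refine ellOne_of_norm_le (ellOne_sub h1 (ellOne_shift h1)) (C := ‖2 / √Real.pi‖) fun n => ?_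
  rw [halfP_apply, norm_smul]
  rfl

lemma halfU_mem_ellOne {b : ℕ → 𝕜} (hb : b ∈ ellOne) : halfU b ∈ ellOne := by
  refine ellOne_unshift (ellOne_of_norm_le (ellOne_add (ellOne_shift hb) hb)
    (C := ‖√Real.pi / 2‖) fun n => ?_)
  rw [halfU_apply_succ, norm_smul]
  rfl

lemma Psi_mem_ellOne {a : ℕ → 𝕜} (ha : a ∈ ellOne) : Psi a ∈ ellOne := by
  refine ellOne_of_norm_le ha (C := psi 0) fun n => ?_
  rw [Psi_apply, norm_smul, Real.norm_of_nonneg (psi_pos n).le]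
  gcongr
  exact psi_anti (Nat.zero_le n)

/-- The factors `1/(2n+1)` outweigh `Ψ⁻¹` by `inv_psi_div_le`, so integration recovers the decay
lost in passing from `Ψa` to `a`. -/
lemma intP_mem_ellOne {a : ℕ → 𝕜} (ha : Psi a ∈ ellOne) : intP a ∈ ellOne := by
  have h1 : (fun n : ℕ => (1 / (2 * (n : ℝ) + 1)) • a n) ∈ ellOne := by
    refine ellOne_of_norm_le ha (C := 1) fun n => ?_
    have hp := psi_pos n
    have : (1 / (2 * (n : ℝ) + 1)) • a n = ((psi n)⁻¹ / (2 * (n : ℝ) + 1)) • Psi a n := by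
      rw [Psi_apply, smul_smul]
      congr 1
      field_simp
    rw [this, norm_smul, Real.norm_of_nonneg (by positivity)]
    gcongr
    exact inv_psi_div_le n
  refine ellOne_unshift (ellOne_of_norm_le (ellOne_sub h1 (ellOne_shift (ellOne_shift h1)))
    (C := 1) fun n => ?_)
  rw [intP_apply_succ, one_mul]
  refine le_of_eq ?_
  simp only [Pi.sub_apply]
  push_cast
  rw [show 2 * ((n : ℝ) + 1 + 1) + 1 = 2 * n + 5 by ring]

lemma summable_norm_smul {c : ℕ → ℝ} {C : ℝ} (hc : ∀ n, |c n| ≤ C) {a : ℕ → 𝕜} (ha : a ∈ ellOne) :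
    Summable fun n => ‖c n • a n‖ := by
  have ha' : Summable fun n => ‖a n‖ := ha
  refine Summable.of_nonneg_of_le (fun _ => norm_nonneg _) (fun n => ?_) (ha'.mul_left C)
  rw [norm_smul, Real.norm_eq_abs]
  gcongr
  exact hc n

lemma norm_tsum_smul_le {c : ℕ → ℝ} {C : ℝ} (hc : ∀ n, |c n| ≤ C) {a : ℕ → 𝕜} (ha : a ∈ ellOne) :
    ‖∑' n, c n • a n‖ ≤ C * ∑' n, ‖a n‖ := by
  have ha' : Summable fun n => ‖a n‖ := ha
  have hs := summable_norm_smul hc ha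
  refine (norm_tsum_le_tsum_norm hs).trans ?_
  rw [← tsum_mul_left]
  refine hs.tsum_le_tsum (fun n => ?_) (ha'.mul_left C)
  rw [norm_smul, Real.norm_eq_abs]
  gcongr
  exact hc n

lemma aestronglyMeasurable_tsum_smul {ν : Measure ℝ} {φ : ℕ → ℝ → ℝ} (hφ : ∀ n, Continuous (φ n))
    {a : ℕ → 𝕜} (hs : ∀ᵐ t ∂ν, Summable fun n => φ n t • a n) :
    AEStronglyMeasurable (fun t => ∑' n, φ n t • a n) ν := by
  refine aestronglyMeasurable_of_tendsto_ae Filter.atTop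
    (f := fun N t => ∑ n ∈ Finset.range N, φ n t • a n) (fun N => ?_) ?_
  · have : Continuous fun t => ∑ n ∈ Finset.range N, φ n t • a n := by fun_prop
    exact this.aestronglyMeasurable
  · filter_upwards [hs] with t ht
    exact ht.hasSum.tendsto_sum_nat

/-- The half-integral of a dominated series is computed term by term. -/
lemma hasSum_halfInt {x : ℝ} (hx : -1 ≤ x) {φ : ℕ → ℝ → ℝ} (hφ : ∀ n, Continuous (φ n)) {C : ℝ}
    (hb : ∀ n, ∀ t ∈ Ioc (-1) x, |φ n t| ≤ C) {a : ℕ → 𝕜} (ha : a ∈ ellOne) :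
    IntervalIntegrable (fun t => (√(x - t))⁻¹ • ∑' n, φ n t • a n) volume (-1) x ∧
    HasSum (fun n => halfInt (φ n) x • a n) (halfInt (fun t => ∑' n, φ n t • a n) x) := by
  have ha' : Summable fun n => ‖a n‖ := ha
  have hk := intervalIntegrable_inv_sqrt hx
  have hkm : Measurable fun t => (√(x - t))⁻¹ := by fun_prop
  have hs : ∀ t ∈ Ioc (-1) x, Summable fun n => φ n t • a n := fun t ht =>
    (summable_norm_smul (fun n => hb n t ht) ha).of_norm
  constructor
  · refine (hk.mul_const (C * ∑' n, ‖a n‖)).mono_fun' ?_ ?_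
    · refine hkm.aestronglyMeasurable.smul (aestronglyMeasurable_tsum_smul hφ ?_)
      rw [uIoc_of_le hx]
      filter_upwards [ae_restrict_mem measurableSet_Ioc] with t ht using hs t ht
    · rw [uIoc_of_le hx]
      filter_upwards [ae_restrict_mem measurableSet_Ioc] with t ht
      rw [norm_smul, Real.norm_of_nonneg (by positivity)]
      gcongr
      exact norm_tsum_smul_le (fun n => hb n t ht) ha
  · have h := intervalIntegral.hasSum_integral_of_dominated_convergence (μ := volume)
      (a := -1) (b := x)
      (F := fun n t => (√(x - t))⁻¹ • (φ n t • a n))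
      (f := fun t => (√(x - t))⁻¹ • ∑' n, φ n t • a n)
      (fun n t => (√(x - t))⁻¹ * (C * ‖a n‖))
      (fun n => hkm.aestronglyMeasurable.smul
        ((hφ n).smul continuous_const).aestronglyMeasurable)
      (fun n => Filter.Eventually.of_forall fun t ht => by
        rw [uIoc_of_le hx] at ht
        rw [norm_smul, Real.norm_of_nonneg (by positivity), norm_smul, Real.norm_eq_abs]
        gcongr
        exact hb n t ht)
      (Filter.Eventually.of_forall fun t _ => (ha'.mul_left C).mul_left _)
      (by
        simp only [tsum_mul_left]
        exact hk.mul_const _)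
      (Filter.Eventually.of_forall fun t ht => by
        rw [uIoc_of_le hx] at ht
        exact (hs t ht).hasSum.const_smul _)
    have h2 := h.const_smul (√Real.pi)⁻¹
    convert! h2 using 1
    funext n
    simp only [halfInt, smul_assoc]
    congr 1
    rw [← intervalIntegral.integral_smul_const]
    simp only [smul_eq_mul, mul_smul]

/-- The factor `√(1+t)` removes the singularity of the bound `(1-t²)^{-1/2}` at `-1`, so the
weighted series is dominated on `(-1,x]` for every `x < 1`. -/
lemma abs_sqrtChebU_le {n : ℕ} {t : ℝ} (ht : t ∈ Ico (-1 : ℝ) 1) :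
    |sqrtChebU n t| ≤ (√(1 - t))⁻¹ := by
  have h := abs_chebU_mul_le (n := n) (Ico_subset_Icc_self ht)
  have h1 : 0 < 1 - t := by linarith [ht.2]
  have h2 : 0 < √(1 - t) := Real.sqrt_pos.2 h1
  rw [show 1 - t ^ 2 = (1 + t) * (1 - t) by ring, Real.sqrt_mul (by linarith [ht.1])] at h
  rw [sqrtChebU, abs_mul, abs_of_nonneg (Real.sqrt_nonneg _), ← one_div, le_div_iff₀ h2]
  linarith

lemma abs_sqrtChebU_le_of_le {n : ℕ} {x t : ℝ} (hx : x < 1) (ht : t ∈ Ioc (-1) x) :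
    |sqrtChebU n t| ≤ (√(1 - x))⁻¹ := by
  refine (abs_sqrtChebU_le ⟨ht.1.le, ht.2.trans_lt hx⟩).trans ?_
  have : 0 < √(1 - x) := Real.sqrt_pos.2 (by linarith)
  have := ht.2
  gcongr

lemma abs_chebU_le_inv {n : ℕ} {x : ℝ} (hx : x ∈ Ioo (-1 : ℝ) 1) :
    |chebU n x| ≤ (√(1 - x ^ 2))⁻¹ := by
  rw [← one_div, le_div_iff₀ (Real.sqrt_pos.2 (by nlinarith [hx.1, hx.2]))]
  exact abs_chebU_mul_le (Ioo_subset_Icc_self hx)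

lemma summable_legendre {x : ℝ} (hx : x ∈ Icc (-1 : ℝ) 1) {a : ℕ → 𝕜} (ha : a ∈ ellOne) :
    Summable fun n => ‖legendreP n x • a n‖ :=
  summable_norm_smul (fun n => abs_legendreP_le_one n hx) ha

lemma summable_cheb {x : ℝ} (hx : x ∈ Ioo (-1 : ℝ) 1) {b : ℕ → 𝕜} (hb : b ∈ ellOne) :
    Summable fun n => ‖chebU n x • b n‖ :=
  summable_norm_smul (fun _ => abs_chebU_le_inv hx) hb

lemma legendreSeries_smul_add {x : ℝ} (hx : x ∈ Icc (-1 : ℝ) 1) (c : 𝕜) {a b : ℕ → 𝕜}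
    (ha : a ∈ ellOne) (hb : b ∈ ellOne) :
    legendreSeries (c • a + b) x = c * legendreSeries a x + legendreSeries b x := by
  unfold legendreSeries
  rw [← tsum_mul_left, ← ((summable_legendre hx ha).of_norm.mul_left c).tsum_add
    (summable_legendre hx hb).of_norm]
  simp only [Pi.add_apply, Pi.smul_apply, smul_add, smul_eq_mul, mul_smul_comm]

lemma chebSeries_smul_add {x : ℝ} (hx : x ∈ Ioo (-1 : ℝ) 1) (c : 𝕜) {a b : ℕ → 𝕜}
    (ha : a ∈ ellOne) (hb : b ∈ ellOne) :
    chebSeries (c • a + b) x = c * chebSeries a x + chebSeries b x := by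
  unfold chebSeries
  rw [← tsum_mul_left, ← ((summable_cheb hx ha).of_norm.mul_left c).tsum_add
    (summable_cheb hx hb).of_norm]
  simp only [Pi.add_apply, Pi.smul_apply, smul_add, smul_eq_mul, mul_smul_comm]

lemma sqrt_smul_chebSeries (b : ℕ → 𝕜) (x : ℝ) :
    √(1 + x) • chebSeries b x = ∑' n, sqrtChebU n x • b n := by
  simp only [chebSeries, sqrtChebU, mul_smul, tsum_const_smul'']

/-- The half-integral of a Legendre expansion. -/
lemma halfInt_legendreSeries {x : ℝ} (hx : x ∈ Ioo (-1 : ℝ) 1) {a : ℕ → 𝕜} (ha : a ∈ ellOne) :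
    IntervalIntegrable (fun t => (√(x - t))⁻¹ • legendreSeries a t) volume (-1) x ∧
    halfInt (legendreSeries a) x = √(1 + x) • chebSeries (halfP a) x := by
  obtain ⟨h1, h2⟩ := hasSum_halfInt hx.1.le continuous_legendreP (C := 1)
    (fun n t ht => abs_legendreP_le_one n ⟨ht.1.le, ht.2.trans hx.2.le⟩) ha
  refine ⟨h1, h2.unique ?_⟩
  set c : ℕ → 𝕜 := fun n => (2 / √Real.pi) • (1 / (2 * (n : ℝ) + 1)) • a n with hc
  have hcm : c ∈ ellOne := by
    refine ellOne_of_norm_le ha (C := ‖2 / √Real.pi‖) fun n => ?_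
    simp only [hc]
    rw [norm_smul]
    gcongr
    simpa using norm_inv_odd_smul_le n (a n)
  have s1 := (summable_cheb hx hcm).of_norm.hasSum
  have s2 := (summable_cheb hx (ellOne_shift hcm)).of_norm.hasSum
  have hP : chebSeries (halfP a) x
      = (∑' n, chebU n x • c n) - ∑' n, chebU n x • c (n + 1) := by
    rw [← (s1.sub s2).tsum_eq, chebSeries]
    refine tsum_congr fun n => ?_
    rw [halfP_apply, smul_sub, smul_sub]
  -- Summation by parts: the shift moves from the coefficient `c (n + 1)` to the polynomial `Uₙ₋₁`,
  -- with `U₋₁ = 0`.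
  have s3 : HasSum (fun n => (if n = 0 then 0 else chebU (n - 1) x • c n))
      (∑' n, chebU n x • c (n + 1)) := by
    rw [← hasSum_nat_add_iff' 1]
    simpa using s2
  rw [hP]
  convert! (s1.sub s3).const_smul (√(1 + x)) using 1
  funext n
  have h := halfInt_legendreP hx.1.le n
  have hn : 2 * (n : ℝ) + 1 ≠ 0 := by positivity
  have h' : halfInt (legendreP n) x
      = √(1 + x) * (chebDiff n).eval x * (2 / √Real.pi * (1 / (2 * (n : ℝ) + 1))) := by
    field_simp at h ⊢
    linear_combination h
  rw [h', mul_smul, mul_smul, mul_smul]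
  congr 1
  rcases n with - | n
  · rw [eval_chebDiff_zero]
    simp [hc]
  · rw [eval_chebDiff_succ]
    simp only [hc, Nat.succ_ne_zero, if_false, Nat.add_sub_cancel, sub_smul]

/-- The half-integral of a weighted Chebyshev expansion. -/
lemma halfInt_sqrt_smul_chebSeries {x : ℝ} (hx : x ∈ Ioo (-1 : ℝ) 1) {b : ℕ → 𝕜}
    (hb : b ∈ ellOne) :
    IntervalIntegrable (fun t => (√(x - t))⁻¹ • √(1 + t) • chebSeries b t) volume (-1) x ∧
    halfInt (fun t => √(1 + t) • chebSeries b t) x = legendreSeries (halfU b) x := by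
  simp only [sqrt_smul_chebSeries]
  obtain ⟨h1, h2⟩ := hasSum_halfInt hx.1.le continuous_sqrtChebU
    (fun n t ht => abs_sqrtChebU_le_of_le hx.2 ht) hb
  refine ⟨h1, h2.unique ?_⟩
  have hx' := Ioo_subset_Icc_self hx
  have s1 := (summable_legendre hx' hb).of_norm.hasSum
  have s2 : HasSum (fun n => legendreP (n + 1) x • b n) (∑' n, legendreP (n + 1) x • b n) :=
    (summable_norm_smul (fun n => abs_legendreP_le_one (n + 1) hx') hb).of_norm.hasSum
  have s3 : HasSum (fun n => (if n = 0 then 0 else legendreP n x • b (n - 1)))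
      (∑' n, legendreP (n + 1) x • b n) := by
    rw [← hasSum_nat_add_iff' 1]
    simpa using s2
  have hU : legendreSeries (halfU b) x = (√Real.pi / 2) •
      ((∑' n, legendreP n x • b n) + ∑' n, legendreP (n + 1) x • b n) := by
    rw [← ((s1.add s3).const_smul (√Real.pi / 2)).tsum_eq, legendreSeries]
    refine tsum_congr fun n => ?_
    rcases n with - | n
    · rw [halfU_apply_zero, smul_comm]
      simp
    · rw [halfU_apply_succ, smul_comm]
      simp
  rw [hU]
  convert! (s1.add s2).const_smul (√Real.pi / 2) using 1
  funext n
  rw [halfInt_sqrtChebU hx.1, mul_smul, add_smul]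

/-- The coefficients of the weighted Chebyshev part of the reconstructed function. -/
noncomputable def chebCoef (σ : 𝕜) (a f : ℕ → 𝕜) : ℕ → 𝕜 := σ⁻¹ • (f - halfP a)

lemma chebCoef_mem_ellOne (σ : 𝕜) {a f : ℕ → 𝕜} (ha : a ∈ ellOne) (hf : f ∈ ellOne) :
    chebCoef σ a f ∈ ellOne :=
  ellOne_smul _ (ellOne_sub hf (halfP_mem_ellOne ha))

lemma solFun_eq (σ : 𝕜) {a f : ℕ → 𝕜} (ha : a ∈ ellOne) (hf : f ∈ ellOne) {x : ℝ}
    (hx : x ∈ Ioo (-1 : ℝ) 1) :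
    solFun σ a f x = legendreSeries a x + √(1 + x) • chebSeries (chebCoef σ a f) x := by
  have hP := halfP_mem_ellOne ha
  have h1 : chebCoef σ a f = σ⁻¹ • f + (-σ⁻¹) • halfP a := by
    rw [chebCoef, smul_sub, neg_smul, sub_eq_add_neg]
  have h2 := chebSeries_smul_add hx (-σ⁻¹) hP (b := 0) (by simp [ellOne])
  rw [add_zero] at h2
  rw [solFun, h1, chebSeries_smul_add hx _ hf (ellOne_smul _ hP), h2]
  simp only [chebSeries, Pi.zero_apply, smul_zero, tsum_zero]
  congr 2
  ring

/-- A solution of the Schur complement equation yields a solution of the half-integral equation. -/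
lemma half_integral_equation {σ : 𝕜} (hσ : σ ≠ 0) {a e f : ℕ → 𝕜} (ha : a ∈ ellOne)
    (hf : f ∈ ellOne)
    (h : (intP - σ ^ 2 • 1 : Module.End 𝕜 (ℕ → 𝕜)) a = halfU f - σ • e) {x : ℝ}
    (hx : x ∈ Ioo (-1 : ℝ) 1) :
    IntervalIntegrable (fun t => (√(x - t))⁻¹ • solFun σ a f t) volume (-1) x ∧
      σ * solFun σ a f x + halfInt (solFun σ a f) x = rhsFun e f x := by
  have hP := halfP_mem_ellOne ha
  set b := chebCoef σ a f with hbdef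
  have hb : b ∈ ellOne := chebCoef_mem_ellOne σ ha hf
  have hbf : σ • b + halfP a = f := by
    rw [hbdef, chebCoef, smul_smul, mul_inv_cancel₀ hσ, one_smul, sub_add_cancel]
  -- Undoing the elimination: apply `halfU` to the second row, subtract the Schur equation, and
  -- cancel `σ`.
  have hae : σ • a + halfU b = e := by
    have h' : halfU (halfP a) - σ ^ 2 • a = halfU f - σ • e := h
    have h2 : σ • halfU b + halfU (halfP a) = halfU f := by rw [← map_smul, ← map_add, hbf]
    have h3 : σ • (σ • a + halfU b) = σ • e := by
      rw [smul_add, smul_smul, ← sq, eq_sub_of_add_eq h2]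
      rw [sub_eq_sub_iff_add_eq_add] at h'
      rw [← sub_eq_zero] at h' ⊢
      rw [← neg_eq_zero, ← h']
      abel
    exact smul_right_injective _ hσ h3
  obtain ⟨i1, q1⟩ := halfInt_legendreSeries hx ha
  obtain ⟨i2, q2⟩ := halfInt_sqrt_smul_chebSeries hx hb
  have hcongr : ∀ t ∈ uIoc (-1) x, (√(x - t))⁻¹ • solFun σ a f t
      = (√(x - t))⁻¹ • legendreSeries a t + (√(x - t))⁻¹ • √(1 + t) • chebSeries b t := by
    intro t ht
    rw [uIoc_of_le hx.1.le] at ht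
    rw [solFun_eq σ ha hf ⟨ht.1, ht.2.trans_lt hx.2⟩, smul_add]
  refine ⟨(i1.add i2).congr fun t ht => (hcongr t ht).symm, ?_⟩
  have hQ : halfInt (solFun σ a f) x
      = √(1 + x) • chebSeries (halfP a) x + legendreSeries (halfU b) x := by
    rw [← q1, ← q2]
    unfold halfInt
    rw [← smul_add, ← intervalIntegral.integral_add i1 i2, intervalIntegral.integral_congr_ae
      (Filter.Eventually.of_forall hcongr)]
  rw [hQ, solFun_eq σ ha hf hx, rhsFun, ← hae, ← hbf,
    legendreSeries_smul_add (Ioo_subset_Icc_self hx) _ ha (halfU_mem_ellOne hb),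
    chebSeries_smul_add hx _ hb hP]
  rw [hbf, ← hbdef]
  simp only [RCLike.real_smul_eq_coe_mul]
  ring

end Series

/-! ### Square integrability up to the right endpoint -/

section SquareIntegrable

variable {𝕜 : Type*} [RCLike 𝕜]

lemma ae_mem_Ioo : ∀ᵐ x ∂mu, x ∈ Ioo (-1 : ℝ) 1 := by
  rw [mu, ← restrict_Ioo_eq_restrict_Icc]
  exact ae_restrict_mem measurableSet_Ioo

/-- The square integrable weight `(1-x)^{-1/4}`. -/
noncomputable def edgeWeight (x : ℝ) : ℝ := √((√(1 - x))⁻¹)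

lemma edgeWeight_nonneg (x : ℝ) : 0 ≤ edgeWeight x := Real.sqrt_nonneg _

lemma edgeWeight_sq (x : ℝ) : edgeWeight x ^ 2 = (√(1 - x))⁻¹ := Real.sq_sqrt (by positivity)

lemma memLp_edgeWeight : MemLp edgeWeight 2 mu := by
  have hm : Measurable edgeWeight := by
    unfold edgeWeight
    fun_prop
  rw [memLp_two_iff_integrable_sq hm.aestronglyMeasurable]
  simp only [edgeWeight_sq]
  have h := intervalIntegrable_inv_sqrt (a := -1) (x := 1) (by norm_num)
  rw [intervalIntegrable_iff_integrableOn_Icc_of_le (by norm_num)] at h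
  exact h

lemma memLp_of_norm_le_edgeWeight {F : ℝ → 𝕜} (hF : AEStronglyMeasurable F mu) {C : ℝ}
    (h : ∀ x ∈ Ioo (-1 : ℝ) 1, ‖F x‖ ≤ C * edgeWeight x) : MemLp F 2 mu := by
  refine (memLp_edgeWeight.const_mul C).mono' hF ?_
  filter_upwards [ae_mem_Ioo] with x hx using h x hx

/-- Since `1 - t = (1-x) + (x-t) ≥ √(1-x) √(x-t)`, half of the singularity of `(1-t)^{-1/2}` moves
to `x`; the other half leaves a kernel that is still integrable. -/
lemma inv_sqrt_mul_inv_sqrt_le {x t : ℝ} (hx : x < 1) (ht : t ≤ x) :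
    (√(x - t))⁻¹ * (√(1 - t))⁻¹ ≤ edgeWeight x * (x - t) ^ (-(3 / 4) : ℝ) := by
  rcases ht.eq_or_lt with rfl | ht
  · simp
  have hy : 0 < x - t := sub_pos.2 ht
  have hp : 0 < √(1 - x) := Real.sqrt_pos.2 (by linarith)
  have hq : 0 < √(x - t) := Real.sqrt_pos.2 hy
  have h1 : (√(1 - t))⁻¹ ≤ edgeWeight x * √((√(x - t))⁻¹) := by
    rw [edgeWeight, ← Real.sqrt_mul (by positivity)]
    refine Real.le_sqrt_of_sq_le ?_
    rw [inv_pow, Real.sq_sqrt (by linarith), ← mul_inv]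
    gcongr
    have e1 : √(1 - x) ^ 2 = 1 - x := Real.sq_sqrt (by linarith)
    have e2 : √(x - t) ^ 2 = x - t := Real.sq_sqrt hy.le
    nlinarith [sq_nonneg (√(1 - x) - √(x - t)), mul_pos hp hq]
  have h2 : (x - t) ^ (-(3 / 4) : ℝ) = (√(x - t))⁻¹ * √((√(x - t))⁻¹) := by
    rw [Real.sqrt_eq_rpow (x - t), Real.sqrt_eq_rpow, ← Real.rpow_neg hy.le, ← Real.rpow_mul hy.le,
      ← Real.rpow_add hy]
    norm_num
  rw [h2, mul_left_comm]
  gcongr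

lemma norm_halfInt_le {u : ℝ → 𝕜} {C : ℝ} (hC : 0 ≤ C)
    (hu : ∀ t ∈ Ioo (-1 : ℝ) 1, ‖u t‖ ≤ C * (√(1 - t))⁻¹) {x : ℝ} (hx : x ∈ Ioo (-1 : ℝ) 1) :
    ‖halfInt u x‖ ≤ C * 8 * edgeWeight x := by
  have hi : IntervalIntegrable (fun t => (x - t) ^ (-(3 / 4) : ℝ)) volume (-1) x := by
    have h : IntervalIntegrable (fun s : ℝ => s ^ (-(3 / 4) : ℝ)) volume (x - -1) (x - x) :=
      intervalIntegral.intervalIntegrable_rpow' (by norm_num)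
    simpa only [sub_sub_cancel] using h.comp_sub_left x
  -- The integral is `4 (x+1)^{1/4}`, and `x + 1 ≤ 2`.
  have hval : ∫ t in (-1 : ℝ)..x, (x - t) ^ (-(3 / 4) : ℝ) ≤ 8 := by
    rw [intervalIntegral.integral_comp_sub_left (fun s => s ^ (-(3 / 4) : ℝ)) x,
      integral_rpow (Or.inl (by norm_num)), sub_self, sub_neg_eq_add,
      show (-(3 / 4) + 1 : ℝ) = 1 / 4 by norm_num, Real.zero_rpow (by norm_num)]
    have h2 : (x + 1) ^ (1 / 4 : ℝ) ≤ 2 := by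
      calc (x + 1) ^ (1 / 4 : ℝ) ≤ 2 ^ (1 / 4 : ℝ) := by
            have := hx.1
            have := hx.2
            gcongr <;> linarith
        _ ≤ 2 ^ (1 : ℝ) := Real.rpow_le_rpow_of_exponent_le one_le_two (by norm_num)
        _ = 2 := Real.rpow_one 2
    linarith
  have hb : ‖∫ t in (-1 : ℝ)..x, (√(x - t))⁻¹ • u t‖
      ≤ ∫ t in (-1 : ℝ)..x, C * edgeWeight x * (x - t) ^ (-(3 / 4) : ℝ) := by
    refine intervalIntegral.norm_integral_le_of_norm_le hx.1.le
      (Filter.Eventually.of_forall fun t ht => ?_) (hi.const_mul _)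
    rw [norm_smul, Real.norm_of_nonneg (by positivity)]
    calc (√(x - t))⁻¹ * ‖u t‖ ≤ (√(x - t))⁻¹ * (C * (√(1 - t))⁻¹) := by
          gcongr
          exact hu t ⟨ht.1, ht.2.trans_lt hx.2⟩
      _ = C * ((√(x - t))⁻¹ * (√(1 - t))⁻¹) := by ring
      _ ≤ C * (edgeWeight x * (x - t) ^ (-(3 / 4) : ℝ)) := by
          exact mul_le_mul_of_nonneg_left (inv_sqrt_mul_inv_sqrt_le hx.2 ht.2) hC
      _ = _ := by ring
  rw [intervalIntegral.integral_const_mul] at hb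
  have hpi : (√Real.pi)⁻¹ ≤ 1 :=
    inv_le_one_of_one_le₀ (Real.one_le_sqrt.2 (by linarith [Real.pi_gt_three]))
  rw [halfInt, norm_smul, Real.norm_of_nonneg (by positivity)]
  have he := edgeWeight_nonneg x
  calc _ ≤ 1 * (C * edgeWeight x * 8) := by gcongr; exact hb.trans (by gcongr)
    _ = _ := by ring

lemma aestronglyMeasurable_legendreSeries {a : ℕ → 𝕜} (ha : a ∈ ellOne) :
    AEStronglyMeasurable (legendreSeries a) mu := by
  refine aestronglyMeasurable_tsum_smul continuous_legendreP ?_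
  filter_upwards [ae_mem_Ioo] with x hx
  exact (summable_legendre (Ioo_subset_Icc_self hx) ha).of_norm

lemma aestronglyMeasurable_sqrt_smul_chebSeries {b : ℕ → 𝕜} (hb : b ∈ ellOne) :
    AEStronglyMeasurable (fun x => √(1 + x) • chebSeries b x) mu := by
  refine AEStronglyMeasurable.smul (by fun_prop : Continuous fun x : ℝ =>
    √(1 + x)).aestronglyMeasurable (aestronglyMeasurable_tsum_smul continuous_chebU ?_)
  filter_upwards [ae_mem_Ioo] with x hx
  exact (summable_cheb hx hb).of_norm

lemma norm_legendreSeries_le {a : ℕ → 𝕜} (ha : a ∈ ellOne) {x : ℝ} (hx : x ∈ Ioo (-1 : ℝ) 1) :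
    ‖legendreSeries a x‖ ≤ ellOneNorm a := by
  have h := norm_tsum_smul_le (fun n => abs_legendreP_le_one n (Ioo_subset_Icc_self hx)) ha
  rwa [one_mul] at h

lemma norm_sqrt_smul_chebSeries_le {b : ℕ → 𝕜} (hb : b ∈ ellOne) {x : ℝ}
    (hx : x ∈ Ioo (-1 : ℝ) 1) :
    ‖√(1 + x) • chebSeries b x‖ ≤ (√(1 - x))⁻¹ * ellOneNorm b := by
  rw [sqrt_smul_chebSeries]
  exact norm_tsum_smul_le (fun n => abs_sqrtChebU_le (Ioo_subset_Ico_self hx)) hb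

lemma ellOneNorm_nonneg (a : ℕ → 𝕜) : 0 ≤ ellOneNorm a := tsum_nonneg fun _ => norm_nonneg _

lemma one_le_two_mul_inv_sqrt {x : ℝ} (hx : x ∈ Ioo (-1 : ℝ) 1) : 1 ≤ 2 * (√(1 - x))⁻¹ := by
  have hp : 0 < √(1 - x) := Real.sqrt_pos.2 (by linarith [hx.2])
  rw [← div_eq_mul_inv, one_le_div hp, Real.sqrt_le_left two_pos.le]
  linarith [hx.1]

lemma norm_solFun_le (σ : 𝕜) {a f : ℕ → 𝕜} (ha : a ∈ ellOne) (hf : f ∈ ellOne) {x : ℝ}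
    (hx : x ∈ Ioo (-1 : ℝ) 1) :
    ‖solFun σ a f x‖ ≤ (2 * ellOneNorm a + ellOneNorm (chebCoef σ a f)) * (√(1 - x))⁻¹ := by
  rw [solFun_eq σ ha hf hx]
  refine (norm_add_le _ _).trans ?_
  have h1 := norm_legendreSeries_le ha hx
  have h2 := norm_sqrt_smul_chebSeries_le (chebCoef_mem_ellOne σ ha hf) hx
  have h3 := mul_le_mul_of_nonneg_left (one_le_two_mul_inv_sqrt hx) (ellOneNorm_nonneg a)
  linarith

lemma aestronglyMeasurable_solFun (σ : 𝕜) {a f : ℕ → 𝕜} (ha : a ∈ ellOne) (hf : f ∈ ellOne) :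
    AEStronglyMeasurable (solFun σ a f) mu := by
  refine ((aestronglyMeasurable_legendreSeries ha).add
    (aestronglyMeasurable_sqrt_smul_chebSeries (chebCoef_mem_ellOne σ ha hf))).congr ?_
  filter_upwards [ae_mem_Ioo] with x hx using (solFun_eq σ ha hf hx).symm

lemma memLp_halfInt_solFun (σ : 𝕜) {a f : ℕ → 𝕜} (ha : a ∈ ellOne) (hf : f ∈ ellOne) :
    MemLp (halfInt (solFun σ a f)) 2 mu := by
  have h1 := ellOneNorm_nonneg a
  have h2 := ellOneNorm_nonneg (chebCoef σ a f)
  exact memLp_of_norm_le_edgeWeight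
    (aestronglyMeasurable_halfInt (aestronglyMeasurable_solFun σ ha hf))
    fun x hx => norm_halfInt_le (by positivity) (fun t ht => norm_solFun_le σ ha hf ht) hx

/-- The half-integral term is in `L²` whether or not the solution is, so it can be moved across the
equation. -/
lemma memLp_solFun_iff {σ : 𝕜} (hσ : σ ≠ 0) {a e f : ℕ → 𝕜} (ha : a ∈ ellOne) (hf : f ∈ ellOne)
    (h : ∀ x ∈ Ioo (-1 : ℝ) 1,
      σ * solFun σ a f x + halfInt (solFun σ a f) x = rhsFun e f x) :
    MemLp (solFun σ a f) 2 mu ↔ MemLp (rhsFun e f) 2 mu := by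
  have hQ := memLp_halfInt_solFun σ ha hf
  constructor
  · intro hu
    refine ((hu.const_mul σ).add hQ).ae_eq ?_
    filter_upwards [ae_mem_Ioo] with x hx using h x hx
  · intro hg
    refine ((hg.sub hQ).const_mul σ⁻¹).ae_eq ?_
    filter_upwards [ae_mem_Ioo] with x hx
    rw [Pi.sub_apply, ← h x hx, add_sub_cancel_right, inv_mul_cancel_left₀ hσ]

/-- The geometric mean of the bounds `(1-x)^{-1/2}` and `2(n+1)`: a factor `√(n+1)` buys square
integrability. -/
lemma abs_sqrtChebU_le_edgeWeight (n : ℕ) {x : ℝ} (hx : x ∈ Ioo (-1 : ℝ) 1) :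
    |sqrtChebU n x| ≤ 2 * edgeWeight x * √((n : ℝ) + 1) := by
  have h1 := abs_sqrtChebU_le (n := n) (Ioo_subset_Ico_self hx)
  have h2 : |sqrtChebU n x| ≤ 2 * ((n : ℝ) + 1) := by
    rw [sqrtChebU, abs_mul, abs_of_nonneg (Real.sqrt_nonneg _)]
    gcongr
    · rw [Real.sqrt_le_left two_pos.le]
      linarith [hx.2]
    · exact abs_chebU_le n hx
  have he := edgeWeight_nonneg x
  refine le_of_sq_le_sq ?_ (by positivity)
  rw [mul_pow, mul_pow, edgeWeight_sq, Real.sq_sqrt (by positivity), sq]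
  refine (mul_le_mul h1 h2 (abs_nonneg _) (by positivity)).trans ?_
  have h3 : 0 ≤ (√(1 - x))⁻¹ * ((n : ℝ) + 1) := by positivity
  linarith

lemma memLp_rhsFun {e f : ℕ → 𝕜} (he : e ∈ ellOne) (hf : f ∈ ellOne)
    (hs : Summable fun n : ℕ => √((n : ℝ) + 1) * ‖f n‖) : MemLp (rhsFun e f) 2 mu := by
  set S := ∑' n : ℕ, √((n : ℝ) + 1) * ‖f n‖ with hS
  have h1 : MemLp (legendreSeries e) 2 mu := by
    refine MemLp.of_bound (aestronglyMeasurable_legendreSeries he) (ellOneNorm e) ?_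
    filter_upwards [ae_mem_Ioo] with x hx using norm_legendreSeries_le he hx
  refine h1.add (memLp_of_norm_le_edgeWeight (aestronglyMeasurable_sqrt_smul_chebSeries hf)
    (C := 2 * S) fun x hx => ?_)
  have hle : ∀ n, ‖sqrtChebU n x • f n‖ ≤ 2 * edgeWeight x * (√((n : ℝ) + 1) * ‖f n‖) := by
    intro n
    rw [norm_smul, Real.norm_eq_abs, ← mul_assoc]
    gcongr
    exact abs_sqrtChebU_le_edgeWeight n hx
  have hs' := hs.mul_left (2 * edgeWeight x)
  rw [sqrt_smul_chebSeries]
  calc ‖∑' n, sqrtChebU n x • f n‖ ≤ ∑' n : ℕ, 2 * edgeWeight x * (√((n : ℝ) + 1) * ‖f n‖) :=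
        tsum_of_norm_bounded hs'.hasSum hle
    _ = 2 * S * edgeWeight x := by
        rw [tsum_mul_left]
        ring

/-! ### The half-integral is not invertible -/

/-- Causality keeps the half-integral zero to the left of `1 - h`, and on the short interval it
equals `2√(x-1+h)/√π`. These indicators are approximate null vectors as `h → 0`. -/
lemma norm_halfInt_indicator_le {h : ℝ} (hh2 : h ≤ 2) {x : ℝ}
    (hx : x ∈ Icc (-1 : ℝ) 1) :
    ‖halfInt ((Ioc (1 - h) 1).indicator fun _ => (1 : 𝕜)) x‖
      ≤ 2 * √h * ‖(Ioc (1 - h) 1).indicator (fun _ => (1 : 𝕜)) x‖ := by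
  by_cases hxh : x ∈ Ioc (1 - h) 1
  · have e : ∫ t in (-1 : ℝ)..x, (√(x - t))⁻¹ • (Ioc (1 - h) 1).indicator (fun _ => (1 : 𝕜)) t
        = ((2 * √(x - (1 - h)) : ℝ) : 𝕜) := by
      rw [← integral_inv_sqrt hxh.1.le, intervalIntegral.integral_of_le hx.1,
        intervalIntegral.integral_of_le hxh.1.le, ← integral_ofReal,
        ← integral_indicator measurableSet_Ioc, ← integral_indicator measurableSet_Ioc]
      congr 1
      funext t
      by_cases ht : t ∈ Ioc (1 - h) x
      · have h1 : t ∈ Ioc (-1) x := ⟨by linarith [ht.1], ht.2⟩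
        have h2 : t ∈ Ioc (1 - h) 1 := ⟨ht.1, ht.2.trans hx.2⟩
        simp [ht, h1, h2, RCLike.real_smul_eq_coe_mul]
      · rw [indicator_of_notMem ht]
        by_cases h1 : t ∈ Ioc (-1) x
        · rw [indicator_of_mem h1, indicator_of_notMem, smul_zero]
          exact fun h2 => ht ⟨h2.1, h1.2⟩
        · rw [indicator_of_notMem h1]
    have hpi : (√Real.pi)⁻¹ ≤ 1 :=
      inv_le_one_of_one_le₀ (Real.one_le_sqrt.2 (by linarith [Real.pi_gt_three]))
    rw [halfInt, e, norm_smul, Real.norm_of_nonneg (by positivity), RCLike.norm_ofReal,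
      abs_of_nonneg (by positivity), indicator_of_mem hxh, norm_one, mul_one]
    calc _ ≤ 1 * (2 * √h) := by
          gcongr
          linarith [hx.2]
      _ = 2 * √h := one_mul _
  · have e : ∫ t in (-1 : ℝ)..x, (√(x - t))⁻¹ • (Ioc (1 - h) 1).indicator (fun _ => (1 : 𝕜)) t
        = 0 := by
      refine intervalIntegral.integral_zero_ae (Filter.Eventually.of_forall fun t ht => ?_)
      rw [uIoc_of_le hx.1] at ht
      rw [indicator_of_notMem, smul_zero]
      intro h2
      exact hxh ⟨h2.1.trans_le ht.2, hx.2⟩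
    rw [halfInt, e, indicator_of_notMem hxh]
    simp

/-- A bounded inverse `S` would force `1 ≤ ‖S‖ · 2√h` for all small `h > 0`. -/
lemma not_isUnit_halfIntL2 : ¬ IsUnit (halfIntL2 𝕜) := by
  rintro ⟨U, hU⟩
  set S : Lp 𝕜 2 mu →L[𝕜] Lp 𝕜 2 mu := ↑(U⁻¹) with hS
  have key : ∀ h : ℝ, 0 < h → h ≤ 2 → 1 ≤ ‖S‖ * (2 * √h) := by
    intro h hh0 hh2
    have hm : mu (Ioc (1 - h) 1) = ENNReal.ofReal h := by
      rw [mu, Measure.restrict_apply measurableSet_Ioc, inter_eq_left.2, Real.volume_Ioc]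
      · congr 1
        ring
      · exact Ioc_subset_Icc_self.trans (Icc_subset_Icc_left (by linarith))
    have hfin : mu (Ioc (1 - h) 1) ≠ ∞ := by
      rw [hm]
      exact ENNReal.ofReal_ne_top
    set u : Lp 𝕜 2 mu := indicatorConstLp 2 measurableSet_Ioc hfin (1 : 𝕜) with hu
    have hpos : 0 < ‖u‖ := by
      rw [hu, norm_indicatorConstLp two_ne_zero ENNReal.ofNat_ne_top, norm_one, one_mul,
        Measure.real, hm, ENNReal.toReal_ofReal hh0.le]
      positivity
    have hQ : ‖halfIntL2 𝕜 u‖ ≤ 2 * √h * ‖u‖ := by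
      refine Lp.norm_le_mul_norm_of_ae_le_mul ?_
      have hcu : u =ᵐ[mu] (Ioc (1 - h) 1).indicator fun _ => (1 : 𝕜) :=
        indicatorConstLp_coeFn
      filter_upwards [coeFn_halfIntL2 u, hcu, ae_restrict_mem measurableSet_Icc] with x h1 h2 hx
      rw [h1, h2, halfInt_congr hcu hx]
      exact norm_halfInt_indicator_le hh2 hx
    have hSu : S (halfIntL2 𝕜 u) = u := by
      rw [← hU, hS]
      exact congrArg (fun T : Lp 𝕜 2 mu →L[𝕜] Lp 𝕜 2 mu => T u) U.inv_mul
    have h3 : ‖u‖ ≤ ‖S‖ * (2 * √h * ‖u‖) := by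
      conv_lhs => rw [← hSu]
      exact (S.le_opNorm _).trans (by gcongr)
    rw [← mul_assoc] at h3
    exact (le_mul_iff_one_le_left hpos).1 h3
  have hlim : Filter.Tendsto (fun h : ℝ => ‖S‖ * (2 * √h)) (nhdsWithin 0 (Ioi 0)) (nhds 0) := by
    have : Continuous fun h : ℝ => ‖S‖ * (2 * √h) := by fun_prop
    have h0 := this.tendsto 0
    simp only [Real.sqrt_zero, mul_zero] at h0
    exact h0.mono_left nhdsWithin_le_nhds
  have h1 : ∀ᶠ h : ℝ in nhdsWithin 0 (Ioi 0), 1 ≤ ‖S‖ * (2 * √h) := by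
    filter_upwards [Ioc_mem_nhdsGT (zero_lt_two : (0 : ℝ) < 2)] with h hh using key h hh.1 hh.2
  have := ge_of_tendsto hlim h1
  linarith

end SquareIntegrable

/-! ### From the sequence equation to the `L²` solution -/

section Equation

variable {𝕜 : Type*} [RCLike 𝕜]

lemma ne_zero_of_isUnit {σ : 𝕜}
    (hσ : IsUnit (σ • (1 : Lp 𝕜 2 mu →L[𝕜] Lp 𝕜 2 mu) + halfIntL2 𝕜)) : σ ≠ 0 := by
  rintro rfl
  rw [zero_smul, zero_add] at hσ
  exact not_isUnit_halfIntL2 hσ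

/-- The pointwise equation on the open interval holds almost everywhere, and the half-integral
depends only on the almost-everywhere class, so the operator equation follows. -/
lemma toLp_eq_inverse {σ : 𝕜}
    (hσ : IsUnit (σ • (1 : Lp 𝕜 2 mu →L[𝕜] Lp 𝕜 2 mu) + halfIntL2 𝕜)) {u g : ℝ → 𝕜}
    (hu : MemLp u 2 mu) (hg : MemLp g 2 mu)
    (h : ∀ x ∈ Ioo (-1 : ℝ) 1, σ * u x + halfInt u x = g x) :
    hu.toLp u = Ring.inverse (σ • (1 : Lp 𝕜 2 mu →L[𝕜] Lp 𝕜 2 mu) + halfIntL2 𝕜) (hg.toLp g) := by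
  set T := σ • (1 : Lp 𝕜 2 mu →L[𝕜] Lp 𝕜 2 mu) + halfIntL2 𝕜 with hT
  have hTu : T (hu.toLp u) = hg.toLp g := by
    refine Lp.ext ?_
    have e : T (hu.toLp u) = σ • hu.toLp u + halfIntL2 𝕜 (hu.toLp u) := rfl
    rw [e]
    filter_upwards [Lp.coeFn_add (σ • hu.toLp u) (halfIntL2 𝕜 (hu.toLp u)),
      Lp.coeFn_smul σ (hu.toLp u), coeFn_halfIntL2 (hu.toLp u), hu.coeFn_toLp, hg.coeFn_toLp,
      ae_mem_Ioo] with x h1 h2 h3 h4 h5 hx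
    rw [h1, Pi.add_apply, h2, Pi.smul_apply, h3, h4, h5, ← h x hx, smul_eq_mul,
      halfInt_congr hu.coeFn_toLp (Ioo_subset_Icc_self hx)]
  rw [← hTu]
  exact (congrArg (fun S : Lp 𝕜 2 mu →L[𝕜] Lp 𝕜 2 mu => S (hu.toLp u))
    (Ring.inverse_mul_cancel T hσ)).symm

lemma schur_equation_of_normalized {σ : 𝕜} {a h : ℕ → 𝕜}
    (ha : (intPNormalized - σ ^ 2 • 1 : Module.End 𝕜 (ℕ → 𝕜)) (Psi a) = Psi h) :
    (intP - σ ^ 2 • 1 : Module.End 𝕜 (ℕ → 𝕜)) a = h := by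
  have e : (intPNormalized - σ ^ 2 • 1 : Module.End 𝕜 (ℕ → 𝕜)) (Psi a)
      = Psi ((intP - σ ^ 2 • 1 : Module.End 𝕜 (ℕ → 𝕜)) a) := by
    simp only [LinearMap.sub_apply, LinearMap.smul_apply, Module.End.one_apply, map_sub, map_smul,
      intPNormalized_Psi]
  rw [e] at ha
  rw [← PsiInv_Psi ((intP - σ ^ 2 • 1 : Module.End 𝕜 (ℕ → 𝕜)) a), ha, PsiInv_Psi]

/-- A bootstrap: `σ²a = intP a - h`, and both terms on the right are already summable. -/
lemma mem_ellOne_of_schur_equation {σ : 𝕜} (hσ : σ ≠ 0) {a h : ℕ → 𝕜} (hh : h ∈ ellOne)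
    (ha : Psi a ∈ ellOne) (heq : (intP - σ ^ 2 • 1 : Module.End 𝕜 (ℕ → 𝕜)) a = h) :
    a ∈ ellOne := by
  have h1 : intP a - σ ^ 2 • a = h := heq
  have h2 : a = (σ ^ 2)⁻¹ • (intP a - h) := by
    rw [← h1, sub_sub_cancel, inv_smul_smul₀ (pow_ne_zero 2 hσ)]
  rw [h2]
  exact ellOne_smul _ (ellOne_sub (intP_mem_ellOne ha) hh)

end Equation

end HalfInt

theorem lemmaB3 {𝕜 : Type*} [RCLike 𝕜] (σ : 𝕜)
    (hσ : IsUnit (σ • (1 : Lp 𝕜 2 HalfInt.mu →L[𝕜] Lp 𝕜 2 HalfInt.mu) + HalfInt.halfIntL2 𝕜)) :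
    -- invertibility on `ℓ²_λ`
    (∀ lam : ℝ, 0 ≤ lam →
      HalfInt.IsInvertibleOn (HalfInt.ellTwo lam) (HalfInt.ellTwoNorm lam)
        (σ ^ 2 • 1 + HalfInt.intPNormalized : Module.End 𝕜 (ℕ → 𝕜)) ∧
      HalfInt.IsInvertibleOn (HalfInt.ellTwo lam) (HalfInt.ellTwoNorm lam)
        (HalfInt.intPNormalized - σ ^ 2 • 1 : Module.End 𝕜 (ℕ → 𝕜))) ∧
    -- invertibility on `ℓ¹`
    HalfInt.IsInvertibleOn HalfInt.ellOne HalfInt.ellOneNorm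
      (σ ^ 2 • 1 + HalfInt.intPNormalized : Module.End 𝕜 (ℕ → 𝕜)) ∧
    HalfInt.IsInvertibleOn HalfInt.ellOne HalfInt.ellOneNorm
      (HalfInt.intPNormalized - σ ^ 2 • 1 : Module.End 𝕜 (ℕ → 𝕜)) ∧
    ∀ e f : ℕ → 𝕜, e ∈ HalfInt.ellOne → f ∈ HalfInt.ellOne →
      -- the coefficients `a` given by the Schur complement exist and are unique
      (∃! a : ℕ → 𝕜, HalfInt.Psi a ∈ HalfInt.ellOne ∧
        (HalfInt.intPNormalized - σ ^ 2 • 1 : Module.End 𝕜 (ℕ → 𝕜)) (HalfInt.Psi a)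
          = HalfInt.Psi (HalfInt.halfU f - σ • e)) ∧
      ∀ a : ℕ → 𝕜, HalfInt.Psi a ∈ HalfInt.ellOne →
        (HalfInt.intPNormalized - σ ^ 2 • 1 : Module.End 𝕜 (ℕ → 𝕜)) (HalfInt.Psi a)
          = HalfInt.Psi (HalfInt.halfU f - σ • e) →
        a ∈ HalfInt.ellOne ∧
        (HalfInt.intP - σ ^ 2 • 1 : Module.End 𝕜 (ℕ → 𝕜)) a = HalfInt.halfU f - σ • e ∧
        -- all the expansions converge absolutely on `(-1,1)`
        (∀ x ∈ Ioo (-1 : ℝ) 1,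
          Summable (fun n => ‖HalfInt.legendreP n x • e n‖) ∧
          Summable (fun n => ‖HalfInt.legendreP n x • a n‖) ∧
          Summable (fun n => ‖HalfInt.chebU n x • f n‖) ∧
          Summable (fun n => ‖HalfInt.chebU n x • HalfInt.halfP a n‖)) ∧
        -- the reconstructed function solves the half-integral equation on `(-1,1)`
        (∀ x ∈ Ioo (-1 : ℝ) 1,
          IntervalIntegrable (fun t => (√(x - t))⁻¹ • HalfInt.solFun σ a f t) volume (-1) x ∧
          σ * HalfInt.solFun σ a f x + HalfInt.halfInt (HalfInt.solFun σ a f) x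
            = HalfInt.rhsFun e f x) ∧
        -- it is in `L²` exactly when the right-hand side is, and then it is the `L²` solution
        (MemLp (HalfInt.solFun σ a f) 2 HalfInt.mu ↔ MemLp (HalfInt.rhsFun e f) 2 HalfInt.mu) ∧
        (∀ (hu : MemLp (HalfInt.solFun σ a f) 2 HalfInt.mu)
          (hg : MemLp (HalfInt.rhsFun e f) 2 HalfInt.mu),
          hu.toLp (HalfInt.solFun σ a f)
            = Ring.inverse (σ • (1 : Lp 𝕜 2 HalfInt.mu →L[𝕜] Lp 𝕜 2 HalfInt.mu)
                + HalfInt.halfIntL2 𝕜) (hg.toLp (HalfInt.rhsFun e f))) ∧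
        (Summable (fun n : ℕ => √((n : ℝ) + 1) * ‖f n‖) →
          MemLp (HalfInt.rhsFun e f) 2 HalfInt.mu) := by
  have hσ0 := HalfInt.ne_zero_of_isUnit hσ
  have hσ2 : σ ^ 2 ≠ 0 := pow_ne_zero 2 hσ0
  -- No nonzero scalar is an eigenvalue, so the shifts by `σ²` and `-σ²` are handled alike.
  have hsign : (σ ^ 2 • 1 + HalfInt.intPNormalized : Module.End 𝕜 (ℕ → 𝕜))
      = HalfInt.intPNormalized - (-σ ^ 2) • 1 := by
    refine LinearMap.ext fun v => ?_
    simp only [LinearMap.add_apply, LinearMap.sub_apply, LinearMap.smul_apply, neg_smul,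
      sub_neg_eq_add, add_comm]
  have hinv := HalfInt.isInvertibleOn_ellOne hσ2
  refine ⟨fun lam hlam => ⟨?_, HalfInt.isInvertibleOn_ellTwo hσ2 hlam⟩, ?_, hinv,
    fun e f he hf => ?_⟩
  · rw [hsign]
    exact HalfInt.isInvertibleOn_ellTwo (neg_ne_zero.2 hσ2) hlam
  · rw [hsign]
    exact HalfInt.isInvertibleOn_ellOne (neg_ne_zero.2 hσ2)
  have hh : HalfInt.halfU f - σ • e ∈ HalfInt.ellOne :=
    HalfInt.ellOne_sub (HalfInt.halfU_mem_ellOne hf) (HalfInt.ellOne_smul σ he)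
  refine ⟨?_, fun a hΨa ha => ?_⟩
  · obtain ⟨v, hv, hve⟩ := hinv.bijOn.surjOn (HalfInt.Psi_mem_ellOne hh)
    refine ⟨HalfInt.PsiInv v, ?_, fun a ha => ?_⟩
    · simp only [HalfInt.Psi_PsiInv]
      exact ⟨hv, hve⟩
    · rw [← hinv.bijOn.injOn ha.1 hv (ha.2.trans hve.symm), HalfInt.PsiInv_Psi]
  · have hschur := HalfInt.schur_equation_of_normalized ha
    have ha1 := HalfInt.mem_ellOne_of_schur_equation hσ0 hh hΨa hschur
    have heq := fun x (hx : x ∈ Ioo (-1 : ℝ) 1) =>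
      HalfInt.half_integral_equation hσ0 ha1 hf hschur hx
    exact ⟨ha1, hschur, fun x hx =>
      ⟨HalfInt.summable_legendre (Ioo_subset_Icc_self hx) he,
        HalfInt.summable_legendre (Ioo_subset_Icc_self hx) ha1, HalfInt.summable_cheb hx hf,
        HalfInt.summable_cheb hx (HalfInt.halfP_mem_ellOne ha1)⟩,
      heq, HalfInt.memLp_solFun_iff hσ0 ha1 hf fun x hx => (heq x hx).2,
      fun hu hg => HalfInt.toLp_eq_inverse hσ hu hg fun x hx => (heq x hx).2,
      HalfInt.memLp_rhsFun he hf⟩
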